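/- Let $\mathbb{T}^2=(\mathbb{R}/2\pi\mathbb{Z})^2$ with coordinates $(x,y)$, and let $U=U(t,y)$ be a real measurable function on $(0,\infty)\times\mathbb{R}/2\pi\mathbb{Z}$ with $\|U\|_{L^\infty_tL^2_y}=\operatorname{ess\,sup}_{t>0}\|U(t,\cdot)\|_{L^2_y}<\infty$. Let $\rho_0\in L^2(\mathbb{T}^2)$ be real-valued with $\int_{\mathbb{T}^2}\rho_0\,dx\,dy=0$. By a solution of $$\partial_t\rho+U(t,y)\,\partial_x\rho=\Delta\rho,\qquad \rho(0,\cdot)=\rho_0,$$ we mean a function $\rho\in C([0,\infty);L^2(\mathbb{T}^2))$ with $\rho(0)=\rho_0$ and $\rho\in L^2((0,T);H^1(\mathbb{T}^2))$ for every $T<\infty$ that satisfies the equation in the sense of distributions on $(0,\infty)\times\mathbb{T}^2$. Then there is a constant $c_1>0$, depending only on $U$ and $\rho_0$, such that: (i) for every $\theta\in(0,1)$ there is a constant $c_2>c_1$, depending only on $U$, $\rho_0$ and $\theta$, such that every solution satisfies, for all $t\ge 0$, $$\theta\,\|\rho_0\|_{L^2}\,e^{-c_2t}\le\|\rho(t,\cdot)\|_{L^2}\le\|\rho_0\|_{L^2}\,e^{-c_1t};$$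 (ii) if moreover $\rho_0\in H^1(\mathbb{T}^2)$, there is a constant $c_2>c_1$, depending only on $U$ and $\rho_0$, such that every solution satisfies, for all $t\ge 0$, $$\|\rho_0\|_{L^2}\,e^{-c_2t}\le\|\rho(t,\cdot)\|_{L^2}\le\|\rho_0\|_{L^2}\,e^{-c_1t}.$$ -/

import Mathlib

open MeasureTheory Set
open scoped Real ContDiff

noncomputable section

/-- The circle `ℝ / 2πℤ`; its `volume` has total mass `2π`. -/
abbrev Tor : Type := AddCircle (2 * π)

instance factTwoPiPos : Fact (0 < 2 * π) := ⟨Real.two_pi_pos⟩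

/-- The two-dimensional torus, with coordinates `z = (x, y)`. -/
abbrev Torus2 : Type := Tor × Tor

/-- Real-valued `L²(𝕋²)`. -/
abbrev L2Torus : Type := Lp ℝ 2 (volume : Measure Torus2)

/-- Classical partial derivative in `x` of a function on the torus. -/
def partialX (f : Torus2 → ℝ) (z : Torus2) : ℝ :=
  deriv (fun s : ℝ => f (z.1 + (s : Tor), z.2)) 0

/-- Classical partial derivative in `y` of a function on the torus. -/
def partialY (f : Torus2 → ℝ) (z : Torus2) : ℝ :=
  deriv (fun s : ℝ => f (z.1, z.2 + (s : Tor))) 0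

/-- The Laplacian `∂²/∂x² + ∂²/∂y²` on the torus. -/
def laplacianT (f : Torus2 → ℝ) (z : Torus2) : ℝ :=
  partialX (partialX f) z + partialY (partialY f) z

/-- `f` is a smooth function on the torus: its doubly periodic lift to `ℝ²` is smooth. -/
def SmoothOnTorus (f : Torus2 → ℝ) : Prop :=
  ContDiff ℝ ∞ (fun p : ℝ × ℝ => f ((p.1 : Tor), (p.2 : Tor)))

/-- `g` is the weak derivative of `f` in `x`. -/
def HasWeakPartialX (f g : L2Torus) : Prop :=
  ∀ ψ : Torus2 → ℝ, SmoothOnTorus ψ → ∫ z, f z * partialX ψ z = -∫ z, g z * ψ z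

/-- `g` is the weak derivative of `f` in `y`. -/
def HasWeakPartialY (f g : L2Torus) : Prop :=
  ∀ ψ : Torus2 → ℝ, SmoothOnTorus ψ → ∫ z, f z * partialY ψ z = -∫ z, g z * ψ z

/-- The Sobolev space `H¹(𝕋²)`. -/
def MemH1 (f : L2Torus) : Prop :=
  ∃ g₁ g₂ : L2Torus, HasWeakPartialX f g₁ ∧ HasWeakPartialY f g₂

/-- `ρ ∈ L²(0, T; H¹(𝕋²))` for every finite `T`. -/
def MemL2H1Loc (ρ : ℝ → L2Torus) : Prop :=
  ∃ g₁ g₂ : ℝ → L2Torus,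
    (∀ᵐ t ∂(volume.restrict (Ioi (0 : ℝ))),
      HasWeakPartialX (ρ t) (g₁ t) ∧ HasWeakPartialY (ρ t) (g₂ t)) ∧
    ∀ T : ℝ, 0 < T →
      MemLp ρ 2 (volume.restrict (Ioo 0 T)) ∧
      MemLp g₁ 2 (volume.restrict (Ioo 0 T)) ∧
      MemLp g₂ 2 (volume.restrict (Ioo 0 T))

/-- `U ∈ L^∞((0, ∞); L²(𝕋))`, as a jointly measurable function of `(t, y)`. -/
def MemLinftyL2 (U : ℝ → Tor → ℝ) : Prop :=
  AEStronglyMeasurable (Function.uncurry U)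
      ((volume.restrict (Ioi (0 : ℝ))).prod (volume : Measure Tor)) ∧
    essSup (fun t => eLpNorm (U t) 2 (volume : Measure Tor)) (volume.restrict (Ioi (0 : ℝ))) < ⊤

/-- `φ ∈ C_c^∞((0, ∞) × 𝕋²)`. -/
def IsTestFunction (φ : ℝ → Torus2 → ℝ) : Prop :=
  ContDiff ℝ ∞ (fun q : ℝ × ℝ × ℝ => φ q.1 ((q.2.1 : Tor), (q.2.2 : Tor))) ∧
    ∃ a b : ℝ, 0 < a ∧ a < b ∧ ∀ t, t ∉ Icc a b → ∀ z, φ t z = 0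

/-- `ρ` is a solution of `∂ₜρ + U(t,y) ∂ₓρ = Δρ` on `(0, ∞) × 𝕋²` with `ρ(0) = ρ₀`:
it is continuous in time with values in `L²`, lies in `L²_t H¹` on bounded time intervals, and
satisfies the equation in the sense of distributions (recall `U(t,y) ∂ₓρ = ∂ₓ(U(t,y) ρ)`). -/
structure IsSolution (U : ℝ → Tor → ℝ) (ρ₀ : L2Torus) (ρ : ℝ → L2Torus) : Prop where
  continuousOn : ContinuousOn ρ (Ici 0)
  initial : ρ 0 = ρ₀
  memL2H1 : MemL2H1Loc ρ
  equation : ∀ φ : ℝ → Torus2 → ℝ, IsTestFunction φ →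
    ∫ t in Ioi (0 : ℝ), ∫ z : Torus2,
      ρ t z * (deriv (fun s => φ s z) t + U t z.2 * partialX (φ t) z + laplacianT (φ t) z) = 0

end

/-!
In Fourier variables `(k, n)` a shear flow in `x` leaves the streamwise frequency `k` invariant, so
the equation decouples into the systems `aₙ' = -(k² + n²) aₙ - i k ∑ₚ uₙ₋ₚ aₚ` for the coefficients
`aₙ(t)` with `k` fixed, `u` being the Fourier coefficients of `U(t, ·)` (`ModeSystem`,
`IsSolution.modeSystem`). The coupling is skew-adjoint, and its flux out of a finite set of
frequencies involves only the interactions between that set and its complement (`abs_flux_le`).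

* Upper bound. The flux out of `|n| ≤ N` vanishes as `N → ∞`, which gives the energy equality
  (`ModeSystem.energy`); as the mean vanishes, the energy decays at least like `exp (-2 t)`, so
  `c₁ = 1`.

* Lower bound. Let `l` and `h` be the energies in `|n| ≤ m` and in `|n| > m`. The flux between them
  is at most of order `|k| ‖U‖ √m √(l h)`, since the low modes are bounded pointwise by `√m √l`,
  whereas the spectral gap `(m + 1)² - m²` is of order `m`. Hence, for `m` large, the cone `h ≤ l`
  is invariant, and inside it `l` decays at most exponentially
  (`ModeSystem.low_frequency_lower_bound`). For given initial data and finitely many `k`, some `m`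
  puts the data in the cone with almost all of the energy in the low modes, which gives the bound
  with the factor `θ` (`exists_lower_bound`).

* Data in `H¹`. Let `d(t)` be the energy lost up to time `t`, so that `∫₀ᵗ D = d / 2` for the
  dissipation rate `D`. Pairing the solution with its initial value gives
  `d / 2 ≤ C ‖ρ₀‖_{H¹} ∫₀ᵗ √D`, hence `d(t) ≤ C' t` (`ModeSystem.energy_loss_le`,
  `exists_linear_bound`). This controls small times without loss of a constant, and for later times
  the factor `θ = 1 / 2` of the previous bound is absorbed in the rate (`exists_sharp_lower_bound`).

The evolution is used in integrated form throughout: `IsPrimitive f f'` says that `f` is locally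
absolutely continuous on `[0, ∞)` with almost everywhere derivative `f'`.
-/

noncomputable section

open Filter Topology
open scoped ComplexConjugate

/-! ### Primitives of locally integrable functions -/

/-- `f` is, on `[0, ∞)`, the primitive of the locally integrable function `f'`; equivalently, `f` is
locally absolutely continuous on `[0, ∞)` with almost everywhere derivative `f'`. -/
structure IsPrimitive {E : Type*} [NormedAddCommGroup E] [NormedSpace ℝ E]
    (f f' : ℝ → E) : Prop where
  intervalIntegrable : ∀ T, 0 ≤ T → IntervalIntegrable f' volume 0 T
  eq_add : ∀ t, 0 ≤ t → f t = f 0 + ∫ s in (0 : ℝ)..t, f' s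

namespace IsPrimitive

variable {E F : Type*} [NormedAddCommGroup E] [NormedSpace ℝ E]
  [NormedAddCommGroup F] [NormedSpace ℝ F]

theorem add {f f' g g' : ℝ → E} (hf : IsPrimitive f f') (hg : IsPrimitive g g') :
    IsPrimitive (fun t => f t + g t) (fun t => f' t + g' t) where
  intervalIntegrable T hT := (hf.1 T hT).add (hg.1 T hT)
  eq_add t ht := by
    rw [intervalIntegral.integral_add (hf.1 t ht) (hg.1 t ht), hf.2 t ht, hg.2 t ht]
    abel

theorem const_mul {f f' : ℝ → ℝ} (hf : IsPrimitive f f') (c : ℝ) :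
    IsPrimitive (fun t => c * f t) (fun t => c * f' t) where
  intervalIntegrable T hT := (hf.1 T hT).const_mul c
  eq_add t ht := by
    rw [intervalIntegral.integral_const_mul, hf.2 t ht]
    ring

theorem const (c : E) : IsPrimitive (fun _ => c) (fun _ => (0 : E)) where
  intervalIntegrable T _ := by simp
  eq_add t _ := by simp

theorem sum {ι : Type*} (s : Finset ι) {f f' : ι → ℝ → E}
    (h : ∀ i ∈ s, IsPrimitive (f i) (f' i)) :
    IsPrimitive (fun t => ∑ i ∈ s, f i t) (fun t => ∑ i ∈ s, f' i t) := by
  classical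
  induction s using Finset.induction_on with
  | empty => simpa using const (0 : E)
  | insert i s hi ih =>
    simp only [Finset.sum_insert hi]
    exact (h i (by simp)).add (ih fun j hj => h j (by simp [hj]))

theorem clm [CompleteSpace E] [CompleteSpace F] {f f' : ℝ → E} (hf : IsPrimitive f f')
    (L : E →L[ℝ] F) :
    IsPrimitive (fun t => L (f t)) (fun t => L (f' t)) where
  intervalIntegrable T hT :=
    ⟨L.integrable_comp (hf.1 T hT).1, L.integrable_comp (hf.1 T hT).2⟩
  eq_add t ht := by
    rw [L.intervalIntegral_comp_comm (hf.1 t ht), hf.2 t ht, map_add]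

theorem absolutelyContinuous {f f' : ℝ → ℝ} (hf : IsPrimitive f f') {T : ℝ} (hT : 0 ≤ T) :
    AbsolutelyContinuousOnInterval (fun t => f 0 + ∫ s in (0 : ℝ)..t, f' s) 0 T :=
  ((contDiff_const (n := 1) (c := f 0)).contDiffOn.absolutelyContinuousOnInterval).fun_add
    ((hf.1 T hT).absolutelyContinuousOnInterval_intervalIntegral (by simp))

theorem ae_deriv {f f' : ℝ → ℝ} (hf : IsPrimitive f f') {T : ℝ} (hT : 0 ≤ T) :
    ∀ᵐ x, x ∈ uIcc 0 T → deriv (fun t => f 0 + ∫ s in (0 : ℝ)..t, f' s) x = f' x := by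
  filter_upwards [(hf.1 T hT).ae_hasDerivAt_integral] with x hx hxT
  exact ((hx hxT 0 (by simp)).const_add _).deriv

theorem continuousOn {f f' : ℝ → ℝ} (hf : IsPrimitive f f') : ContinuousOn f (Ici 0) := by
  have key : ∀ T, 0 ≤ T → ContinuousOn f (Icc 0 T) := by
    intro T hT
    have := (hf.absolutelyContinuous hT).continuousOn
    rw [uIcc_of_le hT] at this
    exact this.congr fun t ht => hf.2 t ht.1
  intro x hx
  have := (key (x + 1) (by have : (0:ℝ) ≤ x := hx; linarith)) x ⟨hx, by linarith⟩
  refine this.mono_of_mem_nhdsWithin ?_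
  filter_upwards [self_mem_nhdsWithin, mem_nhdsWithin_of_mem_nhds (Iio_mem_nhds (lt_add_one x))]
    with y hy hy' using ⟨hy, le_of_lt hy'⟩

theorem mul {f f' g g' : ℝ → ℝ} (hf : IsPrimitive f f') (hg : IsPrimitive g g') :
    IsPrimitive (fun t => f t * g t) (fun t => f' t * g t + f t * g' t) where
  intervalIntegrable T hT := by
    have hsub : uIcc 0 T ⊆ Ici 0 := by rw [uIcc_of_le hT]; exact Icc_subset_Ici_self
    exact ((hf.1 T hT).mul_continuousOn (hg.continuousOn.mono hsub)).add
      ((hg.1 T hT).continuousOn_mul (hf.continuousOn.mono hsub))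
  eq_add t ht := by
    have h := (hf.absolutelyContinuous ht).integral_deriv_mul_eq_sub (hg.absolutelyContinuous ht)
    simp only [intervalIntegral.integral_same, add_zero, ← hf.2 t ht, ← hg.2 t ht] at h
    rw [← sub_eq_iff_eq_add', ← h]
    refine intervalIntegral.integral_congr_ae ?_
    filter_upwards [hf.ae_deriv ht, hg.ae_deriv ht] with x hx hx' hxt
    have hx0 : 0 ≤ x := by rw [uIoc_of_le ht] at hxt; exact hxt.1.le
    rw [hx (uIoc_subset_uIcc hxt), hx' (uIoc_subset_uIcc hxt), hf.2 x hx0, hg.2 x hx0]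

theorem congr_ae {f f' g g' : ℝ → E} (hf : IsPrimitive f f') (h : ∀ t, 0 ≤ t → g t = f t)
    (h' : ∀ᵐ t ∂(volume.restrict (Ioi (0 : ℝ))), g' t = f' t) : IsPrimitive g g' where
  intervalIntegrable T hT := by
    refine (hf.1 T hT).congr_ae ?_
    rw [uIoc_of_le hT]
    exact ae_restrict_of_ae_restrict_of_subset Ioc_subset_Ioi_self
      (h'.mono fun t ht => ht.symm)
  eq_add t ht := by
    rw [h t ht, h 0 le_rfl, hf.2 t ht]
    congr 1
    refine intervalIntegral.integral_congr_ae' ?_ (by simp [ht])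
    have := (ae_restrict_iff' measurableSet_Ioi).1 h'
    filter_upwards [this] with x hx hx' using (hx hx'.1).symm

/-- **Grönwall's inequality** for locally absolutely continuous functions. -/
theorem le_mul_exp {f f' : ℝ → ℝ} (hf : IsPrimitive f f') {c : ℝ}
    (h : ∀ᵐ t ∂(volume.restrict (Ioi (0 : ℝ))), f' t ≤ c * f t) {t : ℝ} (ht : 0 ≤ t) :
    f t ≤ f 0 * Real.exp (c * t) := by
  have hexp : IsPrimitive (fun t => Real.exp (-c * t)) (fun t => Real.exp (-c * t) * -c) := by
    have hc : Continuous fun t => Real.exp (-c * t) * -c := by fun_prop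
    refine ⟨fun T _ => hc.intervalIntegrable _ _, fun t _ => ?_⟩
    rw [intervalIntegral.integral_eq_sub_of_hasDerivAt (f := fun t => Real.exp (-c * t))]
    · ring
    · intro x _
      simpa using ((hasDerivAt_id x).const_mul (-c)).exp
    · exact hc.intervalIntegrable _ _
  have hm := (hf.mul hexp).2 t ht
  have hle : ∫ s in (0 : ℝ)..t, (f' s * Real.exp (-c * s) + f s * (Real.exp (-c * s) * -c)) ≤ 0 := by
    rw [intervalIntegral.integral_of_le ht]
    refine integral_nonpos_of_ae ?_
    have := ae_restrict_of_ae_restrict_of_subset (Ioc_subset_Ioi_self : Ioc (0:ℝ) t ⊆ Ioi 0) h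
    filter_upwards [this] with s hs
    have := mul_le_mul_of_nonneg_right hs (Real.exp_pos (-c * s)).le
    simp only [Pi.zero_apply]
    linarith
  have h1 : f t * Real.exp (-c * t) ≤ f 0 := by
    simp only [mul_zero, Real.exp_zero, mul_one] at hm
    linarith
  calc f t = f t * Real.exp (-c * t) * Real.exp (c * t) := by
        rw [mul_assoc, ← Real.exp_add]; simp
    _ ≤ _ := mul_le_mul_of_nonneg_right h1 (Real.exp_pos _).le

end IsPrimitive

open Real in
theorem continuous_deriv_smoothTransition : Continuous (deriv smoothTransition) :=
  (smoothTransition.contDiff (n := 1)).continuous_deriv le_rfl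

open Real in
theorem deriv_smoothTransition_eq_zero {x : ℝ} (hx : x ∉ Ioc (0:ℝ) 1) :
    deriv smoothTransition x = 0 := by
  have hz0 : ∀ x, x < 0 → deriv smoothTransition x = 0 := fun x hx => by
    rw [EventuallyEq.deriv_eq (f := fun _ => (0:ℝ)), deriv_const]
    filter_upwards [Iio_mem_nhds hx] with y hy using smoothTransition.zero_of_nonpos (le_of_lt hy)
  simp only [mem_Ioc, not_and_or, not_lt, not_le] at hx
  rcases hx with hx | hx
  · rcases hx.lt_or_eq with hx | rfl
    · exact hz0 x hx
    · have h1 : Tendsto (deriv smoothTransition) (𝓝[<] 0) (𝓝 (deriv smoothTransition 0)) :=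
        continuous_deriv_smoothTransition.continuousAt.mono_left nhdsWithin_le_nhds
      refine tendsto_nhds_unique h1 (tendsto_const_nhds.congr' ?_)
      filter_upwards [self_mem_nhdsWithin] with y hy using (hz0 y hy).symm
  · rw [EventuallyEq.deriv_eq (f := fun _ => (1:ℝ)), deriv_const]
    filter_upwards [Ioi_mem_nhds hx] with y hy using smoothTransition.one_of_one_le (le_of_lt hy)

open Real in
/-- A mollified jump: as `ε → 0⁺`, the derivative of `τ ↦ smoothTransition ((τ - s) / ε)` tends to
the Dirac mass at `s`. -/
theorem tendsto_integral_deriv_smoothTransition_mul {w : ℝ → ℝ} (hw : Continuous w) {s : ℝ}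
    (hs : 0 < s) :
    Tendsto (fun ε : ℝ => ∫ τ in Ioi (0 : ℝ), (ε⁻¹ * deriv smoothTransition ((τ - s) / ε)) * w τ)
      (𝓝[>] 0) (𝓝 (w s)) := by
  have hcd := continuous_deriv_smoothTransition
  have hpar : Continuous fun ε : ℝ => ∫ x in (0:ℝ)..1, deriv smoothTransition x * w (s + ε * x) := by
    refine intervalIntegral.continuous_parametric_intervalIntegral_of_continuous' ?_ 0 1
    fun_prop
  have hlim := (hpar.tendsto 0).mono_left (nhdsWithin_le_nhds (s := Ioi (0:ℝ)))
  have h0 : ∫ x in (0:ℝ)..1, deriv smoothTransition x * w (s + 0 * x) = w s := by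
    simp only [zero_mul, add_zero, intervalIntegral.integral_mul_const]
    rw [intervalIntegral.integral_deriv_eq_sub
      (fun x _ => (smoothTransition.contDiff (n := 1)).differentiable one_ne_zero x)
      (hcd.intervalIntegrable _ _)]
    simp
  rw [h0] at hlim
  refine hlim.congr' ?_
  filter_upwards [self_mem_nhdsWithin] with ε hε
  have hε : (0:ℝ) < ε := hε
  have hsub := intervalIntegral.integral_comp_add_mul (a := 0) (b := 1)
    (fun τ => deriv smoothTransition ((τ - s) / ε) * w τ) hε.ne' s
  simp only [add_sub_cancel_left, mul_zero, add_zero, mul_one, mul_div_cancel_left₀ _ hε.ne']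
    at hsub
  rw [hsub, smul_eq_mul, ← intervalIntegral.integral_const_mul,
    intervalIntegral.integral_of_le (by linarith)]
  simp only [← mul_assoc]
  refine (setIntegral_eq_of_subset_of_forall_sdiff_eq_zero measurableSet_Ioi
    (fun x hx => hs.trans hx.1) ?_).symm
  intro x hx
  rw [deriv_smoothTransition_eq_zero, mul_zero, zero_mul]
  intro h
  refine hx.2 ⟨?_, ?_⟩
  · have := (div_pos_iff_of_pos_right hε).1 h.1; linarith
  · have := (div_le_one hε).1 h.2; linarith

open Real in
/-- A continuous function on `[0, ∞)` whose distributional derivative on `(0, ∞)` is integrable on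
bounded intervals is the primitive of that derivative. -/
theorem isPrimitive_of_weak_deriv {w b : ℝ → ℝ} (hw : ContinuousOn w (Ici 0))
    (hb : ∀ T, 0 ≤ T → IntervalIntegrable b volume 0 T)
    (h : ∀ η : ℝ → ℝ, ContDiff ℝ ∞ η →
      (∃ a c : ℝ, 0 < a ∧ a < c ∧ ∀ t, t ∉ Icc a c → η t = 0) →
      ∫ t in Ioi (0 : ℝ), (deriv η t * w t + η t * b t) = 0) : IsPrimitive w b := by
  refine ⟨hb, ?_⟩
  set w' : ℝ → ℝ := fun t => w (max t 0) with hw'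
  have hw'c : Continuous w' := hw.comp_continuous (by fun_prop) (fun x => mem_Ici.2 (le_max_right _ _))
  have hww : ∀ t, 0 ≤ t → w t = w' t := fun t ht => by simp [hw', ht]
  have key : ∀ s t, 0 < s → s < t → w' t - w' s = ∫ x in s..t, b x := by
    intro s t hs hst
    have ht : 0 < t := hs.trans hst
    set P : ℝ → ℝ → ℝ := fun ε τ => smoothTransition ((τ - s) / ε) - smoothTransition ((τ - t) / ε)
    have hPd : ∀ ε τ, deriv (P ε) τ = ε⁻¹ * deriv smoothTransition ((τ - s) / ε)
        - ε⁻¹ * deriv smoothTransition ((τ - t) / ε) := by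
      intro ε τ
      have hd : ∀ r, HasDerivAt (fun τ => smoothTransition ((τ - r) / ε))
          (ε⁻¹ * deriv smoothTransition ((τ - r) / ε)) τ := by
        intro r
        have h1 : HasDerivAt smoothTransition (deriv smoothTransition ((τ - r) / ε))
          ((τ - r) / ε) :=
          ((smoothTransition.contDiff (n := 1)).differentiable one_ne_zero _).hasDerivAt
        have h2 : HasDerivAt (fun τ => (τ - r) / ε) ε⁻¹ τ := by
          simpa using ((hasDerivAt_id τ).sub_const r).div_const ε
        simpa [mul_comm, Function.comp_def] using h1.comp τ h2
      exact ((hd s).sub (hd t)).deriv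
    have hPs : ∀ ε, ContDiff ℝ ∞ (P ε) := fun ε =>
      (smoothTransition.contDiff.comp (by fun_prop)).sub
        (smoothTransition.contDiff.comp (by fun_prop))
    have hP0 : ∀ ε, 0 < ε → ε < 1 → ∀ τ, τ ∉ Icc s (t + 1) → P ε τ = 0 := by
      intro ε hε hε1 τ hτ
      simp only [mem_Icc, not_and_or, not_le] at hτ
      rcases hτ with hτ | hτ
      · simp only [P]
        rw [smoothTransition.zero_of_nonpos (div_nonpos_of_nonpos_of_nonneg (by linarith) hε.le),
          smoothTransition.zero_of_nonpos (div_nonpos_of_nonpos_of_nonneg (by linarith) hε.le),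
          sub_zero]
      · simp only [P]
        rw [smoothTransition.one_of_one_le ((one_le_div hε).2 (by linarith)),
          smoothTransition.one_of_one_le ((one_le_div hε).2 (by linarith)), sub_self]
    have hPb : ∀ ε τ, |P ε τ| ≤ 1 := fun ε τ => by
      have h1 := smoothTransition.nonneg ((τ - s) / ε)
      have h2 := smoothTransition.nonneg ((τ - t) / ε)
      have h3 := smoothTransition.le_one ((τ - s) / ε)
      have h4 := smoothTransition.le_one ((τ - t) / ε)
      exact abs_le.2 ⟨by simp only [P]; linarith, by simp only [P]; linarith⟩
    have hbI : IntegrableOn b (Ioc 0 (t + 1)) :=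
      (intervalIntegrable_iff_integrableOn_Ioc_of_le (by linarith)).1 (hb _ (by linarith))
    have hind : Integrable ((Ioc 0 (t+1)).indicator b) (volume.restrict (Ioi (0:ℝ))) :=
      ((integrable_indicator_iff measurableSet_Ioc).2 hbI).integrableOn
    have hPeq : ∀ ε, 0 < ε → ε < 1 → ∀ τ, 0 < τ →
        P ε τ * b τ = P ε τ * (Ioc 0 (t+1)).indicator b τ := by
      intro ε hε hε1 τ hτ
      by_cases hm : τ ∈ Ioc 0 (t + 1)
      · rw [indicator_of_mem hm]
      · rw [hP0 ε hε hε1 τ (fun h => hm ⟨hτ, h.2⟩)]; simp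
    have hev : ∀ᶠ ε : ℝ in 𝓝[>] 0, 0 < ε ∧ ε < 1 := by
      filter_upwards [self_mem_nhdsWithin, mem_nhdsWithin_of_mem_nhds (Iio_mem_nhds one_pos)]
        with ε h1 h2 using ⟨h1, h2⟩
    -- the zeroth order term converges to the integral of `b` over `(s, t]`
    have hlimb : Tendsto (fun ε => ∫ τ in Ioi (0:ℝ), P ε τ * b τ) (𝓝[>] 0)
        (𝓝 (∫ τ in s..t, b τ)) := by
      have h1 : ∫ τ in s..t, b τ = ∫ τ in Ioi (0:ℝ), (Ioc s t).indicator b τ := by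
        rw [intervalIntegral.integral_of_le hst.le, setIntegral_indicator measurableSet_Ioc,
          inter_eq_self_of_subset_right]
        exact fun x hx => hs.trans hx.1
      rw [h1]
      refine tendsto_integral_filter_of_dominated_convergence
        (fun τ => ‖(Ioc 0 (t+1)).indicator b τ‖) ?_ ?_ hind.norm ?_
      · filter_upwards [hev] with ε hε
        refine (AEStronglyMeasurable.congr (((hPs ε).continuous.aestronglyMeasurable).mul
          hind.aestronglyMeasurable) ?_)
        filter_upwards [ae_restrict_mem measurableSet_Ioi] with τ hτ
        exact (hPeq ε hε.1 hε.2 τ hτ).symm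
      · filter_upwards [hev] with ε hε
        filter_upwards [ae_restrict_mem measurableSet_Ioi] with τ hτ
        rw [hPeq ε hε.1 hε.2 τ hτ, norm_mul]
        exact mul_le_of_le_one_left (norm_nonneg _) (hPb ε τ)
      · filter_upwards [ae_restrict_mem measurableSet_Ioi] with τ hτ
        have hstep : ∀ r, Tendsto (fun ε : ℝ => smoothTransition ((τ - r) / ε)) (𝓝[>] 0)
            (𝓝 (if r < τ then 1 else 0)) := by
          intro r
          refine tendsto_const_nhds.congr' ?_
          split_ifs with hr
          · filter_upwards [self_mem_nhdsWithin,
              mem_nhdsWithin_of_mem_nhds (Iio_mem_nhds (sub_pos.2 hr))] with ε h1 h2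
            exact (smoothTransition.one_of_one_le ((one_le_div h1).2 (le_of_lt h2))).symm
          · filter_upwards [self_mem_nhdsWithin] with ε h1
            exact (smoothTransition.zero_of_nonpos
              (div_nonpos_of_nonpos_of_nonneg (by linarith) (le_of_lt h1))).symm
        have h2 := ((hstep s).sub (hstep t)).mul_const (b τ)
        have hval : ((if s < τ then 1 else 0) - if t < τ then 1 else 0) * b τ
            = (Ioc s t).indicator b τ := by
          by_cases h3 : s < τ <;> by_cases h4 : t < τ
          · simp [h3, h4, indicator, h4.not_ge]
          · simp [h3, h4, indicator, not_lt.1 h4]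
          · exact absurd (hst.trans h4) h3
          · simp [h3, h4, indicator]
        rwa [hval] at h2
    have hI : ∀ r ε, 0 < r → 0 < ε → IntegrableOn
        (fun τ => ε⁻¹ * deriv smoothTransition ((τ - r) / ε) * w' τ) (Ioi 0) := by
      intro r ε _ hε
      have hc : Continuous fun τ => ε⁻¹ * deriv smoothTransition ((τ - r) / ε) * w' τ :=
        ((continuous_const.mul (continuous_deriv_smoothTransition.comp (by fun_prop))).mul hw'c)
      refine (hc.integrable_of_hasCompactSupport
        (HasCompactSupport.intro (isCompact_Icc (a := r) (b := r + ε)) ?_)).integrableOn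
      intro τ hτ
      rw [deriv_smoothTransition_eq_zero, mul_zero, zero_mul]
      intro hm
      refine hτ ⟨?_, ?_⟩
      · have := (div_pos_iff_of_pos_right hε).1 hm.1; linarith
      · have := (div_le_one hε).1 hm.2; linarith
    have hlimw := (tendsto_integral_deriv_smoothTransition_mul hw'c hs).sub
      (tendsto_integral_deriv_smoothTransition_mul hw'c ht)
    have hsum := hlimw.add hlimb
    have hzero : ∀ᶠ ε : ℝ in 𝓝[>] 0,
        (∫ τ in Ioi (0 : ℝ), (ε⁻¹ * deriv smoothTransition ((τ - s) / ε)) * w' τ)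
        - (∫ τ in Ioi (0 : ℝ), (ε⁻¹ * deriv smoothTransition ((τ - t) / ε)) * w' τ)
        + ∫ τ in Ioi (0:ℝ), P ε τ * b τ = 0 := by
      filter_upwards [hev] with ε hε
      have := h (P ε) (hPs ε) ⟨s, t + 1, hs, by linarith, hP0 ε hε.1 hε.2⟩
      rw [← integral_sub (hI s ε hs hε.1) (hI t ε ht hε.1), ← integral_add]
      · refine Eq.trans ?_ this
        refine setIntegral_congr_fun measurableSet_Ioi fun τ hτ => ?_
        simp only [hPd, hww τ (le_of_lt hτ)]
        ring
      · exact (hI s ε hs hε.1).sub (hI t ε ht hε.1)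
      · refine Integrable.congr (hind.bdd_mul (c := 1) (hPs ε).continuous.aestronglyMeasurable
          (ae_of_all _ fun τ => hPb ε τ)) ?_
        filter_upwards [ae_restrict_mem measurableSet_Ioi] with τ hτ
        exact (hPeq ε hε.1 hε.2 τ hτ).symm
    have := tendsto_nhds_unique (hsum.congr' hzero) tendsto_const_nhds
    linarith
  intro t ht
  rcases ht.eq_or_lt with rfl | ht
  · simp
  rw [hww t ht.le, hww 0 le_rfl]
  have hcont : ContinuousWithinAt (fun s => ∫ x in (0:ℝ)..s, b x) (Ioi 0) 0 := by
    have := intervalIntegral.continuousOn_primitive_interval (μ := volume) (f := b) (a := 0) (b := t)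
      (by
        rw [uIcc_of_le ht.le]
        exact (intervalIntegrable_iff_integrableOn_Icc_of_le ht.le).1 (hb t ht.le))
    have := this 0 (by simp)
    refine this.mono_of_mem_nhdsWithin ?_
    rw [uIcc_of_le ht.le]
    filter_upwards [self_mem_nhdsWithin, mem_nhdsWithin_of_mem_nhds (Iio_mem_nhds ht)]
      with y hy hy' using ⟨le_of_lt hy, le_of_lt hy'⟩
  have hl : Tendsto (fun s => w' t - w' s) (𝓝[>] 0) (𝓝 (w' t - w' 0)) :=
    tendsto_const_nhds.sub ((hw'c.tendsto 0).mono_left nhdsWithin_le_nhds)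
  have hr : Tendsto (fun s => (∫ x in (0:ℝ)..t, b x) - ∫ x in (0:ℝ)..s, b x) (𝓝[>] 0)
      (𝓝 ((∫ x in (0:ℝ)..t, b x) - ∫ x in (0:ℝ)..0, b x)) := tendsto_const_nhds.sub hcont
  have heq := tendsto_nhds_unique (hl.congr' ?_) hr
  · simp only [intervalIntegral.integral_same, sub_zero] at heq; linarith
  filter_upwards [self_mem_nhdsWithin, mem_nhdsWithin_of_mem_nhds (Iio_mem_nhds ht)] with s hs hst
  have hs : (0:ℝ) < s := hs
  rw [key s t hs hst, intervalIntegral.integral_interval_sub_left (hb t ht.le) (hb s hs.le)]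

/-- Dominated convergence for primitives. -/
theorem IsPrimitive.of_tendsto {f f' : ℝ → ℝ} {fN fN' : ℕ → ℝ → ℝ}
    (hN : ∀ N, IsPrimitive (fN N) (fN' N)) {H : ℝ → ℝ}
    (hH : ∀ T, 0 ≤ T → IntervalIntegrable H volume 0 T)
    (hbound : ∀ᵐ t ∂(volume.restrict (Ioi (0 : ℝ))), ∀ N, ‖fN' N t‖ ≤ H t)
    (hf : ∀ t, 0 ≤ t → Tendsto (fun N => fN N t) atTop (𝓝 (f t)))
    (hf' : ∀ᵐ t ∂(volume.restrict (Ioi (0 : ℝ))), Tendsto (fun N => fN' N t) atTop (𝓝 (f' t))) :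
    IsPrimitive f f' := by
  have hsub : ∀ T : ℝ, Ioc 0 T ⊆ Ioi (0:ℝ) := fun T => Ioc_subset_Ioi_self
  have hint : ∀ T, 0 ≤ T → IntervalIntegrable f' volume 0 T := by
    intro T hT
    rw [intervalIntegrable_iff_integrableOn_Ioc_of_le hT]
    have hHI := (intervalIntegrable_iff_integrableOn_Ioc_of_le hT).1 (hH T hT)
    have h1 := ae_restrict_of_ae_restrict_of_subset (hsub T) hf'
    have h2 := ae_restrict_of_ae_restrict_of_subset (hsub T) hbound
    refine Integrable.mono' hHI (aestronglyMeasurable_of_tendsto_ae atTop (fun N =>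
      ((intervalIntegrable_iff_integrableOn_Ioc_of_le hT).1 ((hN N).1 T hT)).aestronglyMeasurable)
      h1) ?_
    filter_upwards [h1, h2] with t ht1 ht2
    exact le_of_tendsto ht1.norm (Eventually.of_forall fun N => ht2 N)
  refine ⟨hint, fun t ht => ?_⟩
  have hlim : Tendsto (fun N => ∫ s in (0:ℝ)..t, fN' N s) atTop (𝓝 (∫ s in (0:ℝ)..t, f' s)) := by
    simp only [intervalIntegral.integral_of_le ht]
    refine tendsto_integral_of_dominated_convergence H (fun N =>
      ((intervalIntegrable_iff_integrableOn_Ioc_of_le ht).1 ((hN N).1 t ht)).aestronglyMeasurable)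
      ((intervalIntegrable_iff_integrableOn_Ioc_of_le ht).1 (hH t ht)) (fun N => ?_)
      (ae_restrict_of_ae_restrict_of_subset (hsub t) hf')
    exact (ae_restrict_of_ae_restrict_of_subset (hsub t) hbound).mono fun s hs => hs N
  refine tendsto_nhds_unique (hf t ht) (((hf 0 le_rfl).add hlim).congr fun N => ?_)
  exact ((hN N).2 t ht).symm

/-- The product rule for the squared modulus. -/
theorem IsPrimitive.norm_sq {a a' : ℝ → ℂ} (h : IsPrimitive a a') :
    IsPrimitive (fun t => ‖a t‖ ^ 2) (fun t => 2 * (star (a t) * a' t).re) := by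
  have hre := h.clm Complex.reCLM
  have him := h.clm Complex.imCLM
  refine ((hre.mul hre).add (him.mul him)).congr_ae (fun t _ => ?_) (ae_of_all _ fun t => ?_)
  · rw [← Complex.normSq_eq_norm_sq, Complex.normSq_apply]; rfl
  · simp; ring

/-! ### Estimates for square-summable sequences -/

theorem tsum_mul_le_sqrt_mul_sqrt {ι : Type*} {f g : ι → ℝ} (hf0 : ∀ i, 0 ≤ f i)
    (hg0 : ∀ i, 0 ≤ g i) (hf : Summable fun i => f i ^ 2) (hg : Summable fun i => g i ^ 2) :
    (Summable fun i => f i * g i) ∧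
      ∑' i, f i * g i ≤ √(∑' i, f i ^ 2) * √(∑' i, g i ^ 2) := by
  have hs : Summable fun i => f i * g i :=
    Summable.of_nonneg_of_le (fun i => mul_nonneg (hf0 i) (hg0 i))
      (fun i => by nlinarith [sq_nonneg (f i - g i), sq_nonneg (f i), sq_nonneg (g i)])
      (hf.add hg)
  refine ⟨hs, hs.tsum_le_of_sum_le fun s => ?_⟩
  refine (Real.sum_mul_le_sqrt_mul_sqrt s f g).trans ?_
  gcongr
  · exact hf.sum_le_tsum _ fun i _ => sq_nonneg _
  · exact hg.sum_le_tsum _ fun i _ => sq_nonneg _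

/-- Convolution of two square-summable sequences. -/
theorem convolution_bound {u b : ℤ → ℂ} {M : ℝ} (hM0 : 0 ≤ M) (hu : Summable fun j => ‖u j‖ ^ 2)
    (hM : ∑' j, ‖u j‖ ^ 2 ≤ M ^ 2) (hb : Summable fun n => ‖b n‖ ^ 2) (n : ℤ) :
    (Summable fun p => u (n - p) * b p) ∧
      ‖∑' p, u (n - p) * b p‖ ≤ M * √(∑' p, ‖b p‖ ^ 2) := by
  have hu' : Summable fun p => ‖u (n - p)‖ ^ 2 := (Equiv.subLeft n).summable_iff.2 hu
  have hue : ∑' p, ‖u (n - p)‖ ^ 2 = ∑' j, ‖u j‖ ^ 2 :=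
    (Equiv.subLeft n).tsum_eq fun j => ‖u j‖ ^ 2
  obtain ⟨h1, h2⟩ := tsum_mul_le_sqrt_mul_sqrt (fun p => norm_nonneg (u (n - p)))
    (fun p => norm_nonneg (b p)) hu' hb
  have h1' : Summable fun p => ‖u (n - p) * b p‖ := by simpa only [norm_mul] using h1
  refine ⟨h1'.of_norm, (norm_tsum_le_tsum_norm h1').trans ?_⟩
  simp only [norm_mul]
  refine h2.trans ?_
  rw [hue]
  gcongr
  exact (Real.sqrt_le_sqrt hM).trans_eq (Real.sqrt_sq hM0)

/-- The flux of `∑ ‖a n‖ ^ 2` out of the finite set of modes `S` produced by the skew-adjoint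
operator `-iκ u * ·`. The interactions inside `S` cancel, so that only those with the complement of
`S` contribute. -/
theorem abs_flux_le {a u : ℤ → ℂ} {M : ℝ} (hM0 : 0 ≤ M) (hu : Summable fun j => ‖u j‖ ^ 2)
    (hM : ∑' j, ‖u j‖ ^ 2 ≤ M ^ 2) (hherm : ∀ j, u (-j) = star (u j))
    (ha : Summable fun n => ‖a n‖ ^ 2) (κ : ℝ) (S : Finset ℤ) :
    |∑ n ∈ S, (star (a n) * (-(Complex.I * κ) * ∑' p, u (n - p) * a p)).re| ≤
      |κ| * M * (∑ n ∈ S, ‖a n‖) * √(∑' n, ‖a n‖ ^ 2 - ∑ n ∈ S, ‖a n‖ ^ 2) := by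
  classical
  set b : ℤ → ℂ := fun p => if p ∈ S then 0 else a p with hbdef
  set c : ℤ → ℂ := fun p => if p ∈ S then a p else 0 with hcdef
  have hbc : ∀ p, a p = c p + b p := fun p => by by_cases h : p ∈ S <;> simp [hbdef, hcdef, h]
  have hbn : ∀ p, ‖b p‖ ^ 2 = ‖a p‖ ^ 2 - ‖c p‖ ^ 2 := fun p => by
    by_cases h : p ∈ S <;> simp [hbdef, hcdef, h]
  have hcs : HasSum (fun p => ‖c p‖ ^ 2) (∑ n ∈ S, ‖a n‖ ^ 2) := by
    have : ∑ n ∈ S, ‖a n‖ ^ 2 = ∑ n ∈ S, ‖c n‖ ^ 2 :=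
      Finset.sum_congr rfl fun n hn => by simp [hcdef, hn]
    rw [this]
    exact hasSum_sum_of_ne_finset_zero fun p hp => by simp [hcdef, hp]
  have hbs : HasSum (fun p => ‖b p‖ ^ 2) (∑' n, ‖a n‖ ^ 2 - ∑ n ∈ S, ‖a n‖ ^ 2) := by
    simp only [hbn]; exact ha.hasSum.sub hcs
  have hsplit : ∀ n, ∑' p, u (n - p) * a p
      = ∑ p ∈ S, u (n - p) * a p + ∑' p, u (n - p) * b p := by
    intro n
    have h1 : HasSum (fun p => u (n - p) * c p) (∑ p ∈ S, u (n - p) * a p) := by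
      have : ∑ p ∈ S, u (n - p) * a p = ∑ p ∈ S, u (n - p) * c p :=
        Finset.sum_congr rfl fun n hn => by simp [hcdef, hn]
      rw [this]
      exact hasSum_sum_of_ne_finset_zero fun p hp => by simp [hcdef, hp]
    have h2 := (convolution_bound hM0 hu hM hbs.summable n).1.hasSum
    simp only [hbc, mul_add] at *
    have h3 := h1.add h2
    exact h3.tsum_eq
  set Z : ℂ := ∑ n ∈ S, ∑ p ∈ S, star (a n) * (u (n - p) * a p) with hZ
  -- the interactions inside `S` form a Hermitian form, which `-iκ` makes purely imaginary
  have hZreal : Z.im = 0 := by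
    have : star Z = Z := by
      rw [hZ, star_sum, Finset.sum_comm]
      refine Finset.sum_congr rfl fun n _ => ?_
      rw [star_sum]
      refine Finset.sum_congr rfl fun p _ => ?_
      rw [star_mul, star_mul, star_star, ← hherm, neg_sub]
      ring
    exact Complex.conj_eq_iff_im.1 this
  have hsum : ∑ n ∈ S, (star (a n) * (-(Complex.I * κ) * ∑' p, u (n - p) * a p)).re
      = ∑ n ∈ S, (star (a n) * (-(Complex.I * κ) * ∑' p, u (n - p) * b p)).re := by
    have h0 : ∑ n ∈ S, (star (a n) * (-(Complex.I * κ) * ∑ p ∈ S, u (n - p) * a p)).re = 0 := by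
      have : ∑ n ∈ S, star (a n) * (-(Complex.I * κ) * ∑ p ∈ S, u (n - p) * a p)
          = -(Complex.I * κ) * Z := by
        rw [hZ, Finset.mul_sum]
        refine Finset.sum_congr rfl fun n _ => ?_
        rw [Finset.mul_sum, Finset.mul_sum, Finset.mul_sum]
        refine Finset.sum_congr rfl fun p _ => ?_
        ring
      rw [← Complex.re_sum, this]
      simp [hZreal]
    calc _ = ∑ n ∈ S, ((star (a n) * (-(Complex.I * κ) * ∑ p ∈ S, u (n - p) * a p)).re
          + (star (a n) * (-(Complex.I * κ) * ∑' p, u (n - p) * b p)).re) := by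
          refine Finset.sum_congr rfl fun n _ => ?_
          rw [hsplit n, ← Complex.add_re]
          congr 1
          ring
      _ = _ := by rw [Finset.sum_add_distrib, h0, zero_add]
  rw [hsum]
  calc _ ≤ ∑ n ∈ S, ‖a n‖ * (|κ| * (M * √(∑' n, ‖a n‖ ^ 2 - ∑ n ∈ S, ‖a n‖ ^ 2))) := by
        refine (Finset.abs_sum_le_sum_abs _ _).trans (Finset.sum_le_sum fun n _ => ?_)
        refine (Complex.abs_re_le_norm _).trans ?_
        rw [norm_mul, norm_mul, norm_star, norm_neg, norm_mul, Complex.norm_I, one_mul,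
          Complex.norm_real, Real.norm_eq_abs]
        gcongr
        have := (convolution_bound hM0 hu hM hbs.summable n).2
        rwa [hbs.tsum_eq] at this
    _ = _ := by rw [← Finset.sum_mul]; ring

theorem summable_inv_one_add_int_sq : Summable fun n : ℤ => (1 + (n : ℝ) ^ 2)⁻¹ := by
  refine Summable.of_norm_bounded_eventually (Real.summable_one_div_int_pow.2 one_lt_two) ?_
  filter_upwards [(Set.finite_singleton (0:ℤ)).compl_mem_cofinite] with n hn
  have hn : (n : ℝ) ≠ 0 := by exact_mod_cast hn
  have : (0:ℝ) < (n:ℝ) ^ 2 := by positivity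
  rw [Real.norm_of_nonneg (by positivity), one_div]
  gcongr
  linarith

/-- The constant of the embedding of `H¹` into the absolutely convergent Fourier series on the
circle. -/
def wienerConst : ℝ := √(∑' n : ℤ, (1 + (n : ℝ) ^ 2)⁻¹)

theorem wienerConst_nonneg : 0 ≤ wienerConst := Real.sqrt_nonneg _

theorem sum_norm_le_wienerConst {a : ℤ → ℂ} {κ : ℝ}
    (h : Summable fun n : ℤ => (1 + κ ^ 2 + (n : ℝ) ^ 2) * ‖a n‖ ^ 2) (S : Finset ℤ) :
    ∑ n ∈ S, ‖a n‖ ≤ wienerConst * √(∑' n : ℤ, (1 + κ ^ 2 + (n : ℝ) ^ 2) * ‖a n‖ ^ 2) := by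
  have h1 : ∀ n : ℤ, ‖a n‖ = √((1 + (n:ℝ) ^ 2)⁻¹) * (√(1 + (n:ℝ)^2) * ‖a n‖) := fun n => by
    rw [Real.sqrt_inv, inv_mul_cancel_left₀]
    positivity
  calc ∑ n ∈ S, ‖a n‖ = ∑ n ∈ S, √((1 + (n:ℝ) ^ 2)⁻¹) * (√(1 + (n:ℝ)^2) * ‖a n‖) :=
        Finset.sum_congr rfl fun n _ => h1 n
    _ ≤ √(∑ n ∈ S, √((1 + (n:ℝ) ^ 2)⁻¹) ^ 2) * √(∑ n ∈ S, (√(1 + (n:ℝ)^2) * ‖a n‖) ^ 2) :=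
        Real.sum_mul_le_sqrt_mul_sqrt _ _ _
    _ ≤ _ := by
        unfold wienerConst
        gcongr
        · refine le_trans (Finset.sum_le_sum fun n _ => ?_)
            (summable_inv_one_add_int_sq.sum_le_tsum S fun n _ => by positivity)
          rw [Real.sq_sqrt (by positivity)]
        · refine le_trans (Finset.sum_le_sum fun n _ => ?_)
            (h.sum_le_tsum S fun n _ => by positivity)
          rw [mul_pow, Real.sq_sqrt (by positivity)]
          gcongr
          nlinarith [sq_nonneg κ]

/-! ### The evolution of the Fourier coefficients with a fixed streamwise frequency -/

/-- The Fourier coefficients `a n` of a solution with streamwise frequency `κ`: they satisfy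
`aₙ' = -(κ² + n²) aₙ - iκ ∑ₚ uₙ₋ₚ aₚ`, where `u` is the sequence of Fourier coefficients of the
shear profile, whose `ℓ²` norm is at most `M`, and they are square-summable with an `H¹` norm that
is locally square-integrable in time. -/
structure ModeSystem (κ M : ℝ) (a u : ℤ → ℝ → ℂ) : Prop where
  nonneg : 0 ≤ M
  sq_summable : ∀ t, 0 ≤ t → Summable fun n => ‖a n t‖ ^ 2
  sobolev_bound : ∃ H : ℝ → ℝ, (∀ T, 0 ≤ T → IntervalIntegrable H volume 0 T) ∧
    ∀ᵐ t ∂(volume.restrict (Ioi (0 : ℝ))),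
      (Summable fun n : ℤ => (1 + κ ^ 2 + (n : ℝ) ^ 2) * ‖a n t‖ ^ 2) ∧
        ∑' n : ℤ, (1 + κ ^ 2 + (n : ℝ) ^ 2) * ‖a n t‖ ^ 2 ≤ H t
  shear_bound : ∀ᵐ t ∂(volume.restrict (Ioi (0 : ℝ))), (Summable fun j => ‖u j t‖ ^ 2) ∧
    ∑' j, ‖u j t‖ ^ 2 ≤ M ^ 2
  shear_hermitian : ∀ᵐ t ∂(volume.restrict (Ioi (0 : ℝ))), ∀ j, u (-j) t = star (u j t)
  evolution : ∀ n : ℤ, IsPrimitive (a n) fun t =>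
    -((κ ^ 2 + (n : ℝ) ^ 2 : ℝ) : ℂ) * a n t + -(Complex.I * κ) * ∑' p, u (n - p) t * a p t

/-- The dissipation rate `∑ (κ² + n²) |aₙ|²`. -/
def dissipation (κ : ℝ) (a : ℤ → ℝ → ℂ) (t : ℝ) : ℝ :=
  ∑' n : ℤ, (κ ^ 2 + (n : ℝ) ^ 2) * ‖a n t‖ ^ 2

/-- The rate of transfer of `∑ |aₙ|²` into the finite set of modes `S` by the shear. -/
def flux (κ : ℝ) (a u : ℤ → ℝ → ℂ) (S : Finset ℤ) (t : ℝ) : ℝ :=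
  ∑ n ∈ S, (star (a n t) * (-(Complex.I * κ) * ∑' p, u (n - p) t * a p t)).re

namespace ModeSystem

variable {κ M : ℝ} {a u : ℤ → ℝ → ℂ}

theorem isPrimitive_sum (h : ModeSystem κ M a u) (S : Finset ℤ) :
    IsPrimitive (fun t => ∑ n ∈ S, ‖a n t‖ ^ 2) (fun t =>
      -2 * ∑ n ∈ S, (κ ^ 2 + (n : ℝ) ^ 2) * ‖a n t‖ ^ 2 + 2 * flux κ a u S t) := by
  refine (IsPrimitive.sum S fun n _ => (h.evolution n).norm_sq).congr_ae (fun t _ => rfl)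
    (ae_of_all _ fun t => ?_)
  simp only [flux, Finset.mul_sum, ← Finset.sum_add_distrib]
  refine Finset.sum_congr rfl fun n _ => ?_
  rw [mul_add (star (a n t)), Complex.add_re, mul_add]
  congr 1
  have : star (a n t) * (-((κ ^ 2 + (n : ℝ) ^ 2 : ℝ) : ℂ) * a n t)
      = ((-(κ ^ 2 + (n : ℝ) ^ 2) * ‖a n t‖ ^ 2 : ℝ) : ℂ) := by
    have h2 : star (a n t) * a n t = ((‖a n t‖ ^ 2 : ℝ) : ℂ) := by
      rw [← Complex.normSq_eq_norm_sq]; exact Complex.normSq_eq_conj_mul_self.symm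
    rw [Complex.ofReal_mul, ← h2]; push_cast; ring
  rw [this, Complex.ofReal_re]
  ring

theorem tendsto_sum_Icc {f : ℤ → ℝ} (hf : Summable f) :
    Tendsto (fun N : ℕ => ∑ n ∈ Finset.Icc (-(N : ℤ)) N, f n) atTop (𝓝 (∑' n, f n)) :=
  hf.hasSum.comp Finset.tendsto_Icc_neg

theorem summable_dissipation {b : ℤ → ℂ}
    (h : Summable fun n : ℤ => (1 + κ ^ 2 + (n : ℝ) ^ 2) * ‖b n‖ ^ 2) :
    Summable fun n : ℤ => (κ ^ 2 + (n : ℝ) ^ 2) * ‖b n‖ ^ 2 :=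
  h.of_nonneg_of_le (fun n => by positivity) fun n => by gcongr; linarith

theorem tsum_sobolev {b : ℤ → ℂ} (h0 : Summable fun n => ‖b n‖ ^ 2)
    (h : Summable fun n : ℤ => (1 + κ ^ 2 + (n : ℝ) ^ 2) * ‖b n‖ ^ 2) :
    ∑' n : ℤ, (1 + κ ^ 2 + (n : ℝ) ^ 2) * ‖b n‖ ^ 2
      = ∑' n : ℤ, ‖b n‖ ^ 2 + ∑' n : ℤ, (κ ^ 2 + (n : ℝ) ^ 2) * ‖b n‖ ^ 2 := by
  rw [← h0.tsum_add (summable_dissipation h)]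
  exact tsum_congr fun n => by ring

/-- The energy equality. The flux into `[-N, N]` tends to zero as `N → ∞`, dominated by the
squared `H¹` norm. -/
theorem energy (h : ModeSystem κ M a u) :
    IsPrimitive (fun t => ∑' n, ‖a n t‖ ^ 2) (fun t => -2 * dissipation κ a t) := by
  obtain ⟨H, hH, hHb⟩ := h.sobolev_bound
  have hflux : ∀ᵐ t ∂(volume.restrict (Ioi (0 : ℝ))), ∀ N : ℕ,
      |flux κ a u (Finset.Icc (-(N : ℤ)) N) t| ≤ |κ| * M * wienerConst * √(H t) *
        √(∑' n, ‖a n t‖ ^ 2 - ∑ n ∈ Finset.Icc (-(N : ℤ)) N, ‖a n t‖ ^ 2) := by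
    filter_upwards [hHb, h.shear_bound, h.shear_hermitian, ae_restrict_mem measurableSet_Ioi]
      with t ht hu hu' ht0 N
    refine (abs_flux_le h.nonneg hu.1 hu.2 hu' (h.sq_summable t (le_of_lt ht0)) κ _).trans ?_
    rw [mul_assoc (|κ| * M) wienerConst]
    have hκM : 0 ≤ |κ| * M := mul_nonneg (abs_nonneg _) h.nonneg
    gcongr
    refine (sum_norm_le_wienerConst ht.1 _).trans ?_
    have := wienerConst_nonneg
    gcongr
    exact ht.2
  refine IsPrimitive.of_tendsto (fun N : ℕ => h.isPrimitive_sum (Finset.Icc (-(N : ℤ)) N))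
    (H := fun t => (2 + 2 * (|κ| * M * wienerConst)) * H t) (fun T hT => (hH T hT).const_mul _)
    ?_ (fun t ht => tendsto_sum_Icc (h.sq_summable t ht)) ?_
  · filter_upwards [hHb, hflux, ae_restrict_mem measurableSet_Ioi] with t ht hfl ht0 N
    have hs := h.sq_summable t (le_of_lt ht0)
    have hD := summable_dissipation ht.1
    have hsob := tsum_sobolev hs ht.1
    have h1 : ∑ n ∈ Finset.Icc (-(N : ℤ)) N, (κ ^ 2 + (n : ℝ) ^ 2) * ‖a n t‖ ^ 2 ≤ H t := by
      have := hD.sum_le_tsum (Finset.Icc (-(N : ℤ)) N) fun n _ => by positivity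
      have h0 : 0 ≤ ∑' n, ‖a n t‖ ^ 2 := tsum_nonneg fun n => by positivity
      linarith [ht.2]
    have h1' : 0 ≤ ∑ n ∈ Finset.Icc (-(N : ℤ)) N, (κ ^ 2 + (n : ℝ) ^ 2) * ‖a n t‖ ^ 2 :=
      Finset.sum_nonneg fun n _ => by positivity
    have hH0 : 0 ≤ H t := h1'.trans h1
    have h2 : ∑' n, ‖a n t‖ ^ 2 - ∑ n ∈ Finset.Icc (-(N : ℤ)) N, ‖a n t‖ ^ 2 ≤ H t := by
      have : 0 ≤ ∑ n ∈ Finset.Icc (-(N : ℤ)) N, ‖a n t‖ ^ 2 :=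
        Finset.sum_nonneg fun n _ => by positivity
      have h0 : 0 ≤ ∑' n : ℤ, (κ ^ 2 + (n : ℝ) ^ 2) * ‖a n t‖ ^ 2 :=
        tsum_nonneg fun n => by positivity
      linarith [ht.2]
    have h3 : |flux κ a u (Finset.Icc (-(N : ℤ)) N) t| ≤ |κ| * M * wienerConst * H t := by
      refine (hfl N).trans ?_
      have hc : 0 ≤ |κ| * M * wienerConst :=
        mul_nonneg (mul_nonneg (abs_nonneg _) h.nonneg) wienerConst_nonneg
      calc _ ≤ |κ| * M * wienerConst * √(H t) * √(H t) := by gcongr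
        _ = _ := by rw [mul_assoc, Real.mul_self_sqrt hH0]
    rw [Real.norm_eq_abs, abs_le]
    rw [abs_le] at h3
    constructor <;> nlinarith [h3.1, h3.2]
  · filter_upwards [hHb, hflux, ae_restrict_mem measurableSet_Ioi] with t ht hfl ht0
    have hs := h.sq_summable t (le_of_lt ht0)
    have h1 := (tendsto_sum_Icc (summable_dissipation ht.1)).const_mul (-2)
    have h2 : Tendsto (fun N : ℕ => flux κ a u (Finset.Icc (-(N : ℤ)) N) t) atTop (𝓝 0) := by
      refine squeeze_zero_norm hfl ?_
      have := ((tendsto_const_nhds (x := ∑' n, ‖a n t‖ ^ 2)).sub (tendsto_sum_Icc hs)).sqrt.const_mul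
        (|κ| * M * wienerConst * √(H t))
      simpa using this
    simpa [dissipation] using h1.add (h2.const_mul 2)

theorem ae_summable_dissipation (h : ModeSystem κ M a u) :
    ∀ᵐ t ∂(volume.restrict (Ioi (0 : ℝ))),
      Summable fun n : ℤ => (κ ^ 2 + (n : ℝ) ^ 2) * ‖a n t‖ ^ 2 := by
  obtain ⟨H, -, hHb⟩ := h.sobolev_bound
  exact hHb.mono fun t ht => summable_dissipation ht.1

/-- Exponential decay, in the absence of a mean. -/
theorem decay (h : ModeSystem κ M a u)
    (hκ : ∀ n : ℤ, ∀ t, 0 ≤ t → 1 ≤ κ ^ 2 + (n : ℝ) ^ 2 ∨ a n t = 0) {t : ℝ} (ht : 0 ≤ t) :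
    ∑' n, ‖a n t‖ ^ 2 ≤ (∑' n, ‖a n 0‖ ^ 2) * Real.exp (-2 * t) := by
  refine h.energy.le_mul_exp ?_ ht
  filter_upwards [h.ae_summable_dissipation, ae_restrict_mem measurableSet_Ioi] with s hs hs0
  refine mul_le_mul_of_nonpos_left ?_ (by norm_num)
  refine (h.sq_summable s (le_of_lt hs0)).tsum_le_tsum (fun n => ?_) hs
  rcases hκ n s (le_of_lt hs0) with hn | hn
  · exact le_mul_of_one_le_left (by positivity) hn
  · simp [hn]

/-- The energy of the low frequencies `|n| ≤ m` decays at most exponentially once it dominates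
that of the high frequencies. The reason is that the cone `high ≤ low` is then invariant: on its
boundary the spectral gap `2m + 1` exceeds the flux, which is of order `√m`. -/
theorem low_frequency_lower_bound (h : ModeSystem κ M a u) (m : ℕ)
    (hm : 2 * (|κ| * M) ≤ √(2 * m + 1))
    (h0 : ∑' n, ‖a n 0‖ ^ 2 ≤ 2 * ∑ n ∈ Finset.Icc (-(m : ℤ)) m, ‖a n 0‖ ^ 2)
    {t : ℝ} (ht : 0 ≤ t) :
    (∑ n ∈ Finset.Icc (-(m : ℤ)) m, ‖a n 0‖ ^ 2) *
        Real.exp (-(2 * κ ^ 2 + 2 * m ^ 2 + 2 * (|κ| * M * √(2 * m + 1))) * t) ≤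
      ∑ n ∈ Finset.Icc (-(m : ℤ)) m, ‖a n t‖ ^ 2 := by
  set S := Finset.Icc (-(m : ℤ)) m with hS
  set β : ℝ := |κ| * M * √(2 * m + 1) with hβ
  set α : ℝ := 2 * κ ^ 2 + 2 * m ^ 2 + 2 * β with hα
  have hflux : ∀ᵐ s ∂(volume.restrict (Ioi (0 : ℝ))),
      2 * |flux κ a u S s| ≤ β * ∑' n, ‖a n s‖ ^ 2 := by
    filter_upwards [h.shear_bound, h.shear_hermitian, ae_restrict_mem measurableSet_Ioi]
      with s hu hu' hs0
    have hs := h.sq_summable s (le_of_lt hs0)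
    have h1 := abs_flux_le h.nonneg hu.1 hu.2 hu' hs κ S
    set l := ∑ n ∈ S, ‖a n s‖ ^ 2
    set e := ∑' n, ‖a n s‖ ^ 2
    have hl0 : 0 ≤ l := Finset.sum_nonneg fun n _ => by positivity
    have hle : l ≤ e := hs.sum_le_tsum _ fun n _ => by positivity
    have hcard : ∑ n ∈ S, ‖a n s‖ ≤ √(2 * m + 1) * √l := by
      have := Real.sum_mul_le_sqrt_mul_sqrt S (fun _ => (1:ℝ)) (fun n => ‖a n s‖)
      simp only [one_mul, one_pow, Finset.sum_const, nsmul_eq_mul, mul_one] at this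
      refine this.trans_eq ?_
      congr 2
      rw [hS, Int.card_Icc]
      have : ((m : ℤ) + 1 - -(m : ℤ)).toNat = 2 * m + 1 := by omega
      rw [this]; push_cast; ring
    have hκM : 0 ≤ |κ| * M := mul_nonneg (abs_nonneg _) h.nonneg
    have h2 : |flux κ a u S s| ≤ β * (√l * √(e - l)) := by
      refine h1.trans ?_
      calc |κ| * M * (∑ n ∈ S, ‖a n s‖) * √(e - l)
          ≤ |κ| * M * (√(2 * m + 1) * √l) * √(e - l) := by gcongr
        _ = _ := by rw [hβ]; ring
    have h3 : 2 * (√l * √(e - l)) ≤ e := by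
      have := two_mul_le_add_sq (√l) (√(e - l))
      rw [Real.sq_sqrt hl0, Real.sq_sqrt (by linarith)] at this
      linarith
    have hβ0 : 0 ≤ β := mul_nonneg hκM (Real.sqrt_nonneg _)
    nlinarith [mul_le_mul_of_nonneg_left h3 hβ0]
  -- the flux is at most half of the spectral gap `(m + 1) ^ 2 - m ^ 2`
  have hgap : 2 * β ≤ 2 * m + 1 := by
    have h1 := mul_le_mul_of_nonneg_right hm (Real.sqrt_nonneg (2 * (m:ℝ) + 1))
    rw [Real.mul_self_sqrt (by positivity)] at h1
    linarith
  have hlow : ∀ s, ∑ n ∈ S, (κ ^ 2 + (n : ℝ) ^ 2) * ‖a n s‖ ^ 2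
      ≤ (κ ^ 2 + m ^ 2) * ∑ n ∈ S, ‖a n s‖ ^ 2 := by
    intro s
    rw [Finset.mul_sum]
    refine Finset.sum_le_sum fun n hn => ?_
    rw [hS, Finset.mem_Icc] at hn
    gcongr ?_ * _
    gcongr κ ^ 2 + ?_
    refine sq_le_sq' ?_ ?_
    · exact_mod_cast hn.1
    · exact_mod_cast hn.2
  have hhigh : ∀ᵐ s ∂(volume.restrict (Ioi (0 : ℝ))),
      (κ ^ 2 + (m + 1) ^ 2) * (∑' n, ‖a n s‖ ^ 2 - ∑ n ∈ S, ‖a n s‖ ^ 2)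
        ≤ dissipation κ a s - ∑ n ∈ S, (κ ^ 2 + (n : ℝ) ^ 2) * ‖a n s‖ ^ 2 := by
    filter_upwards [h.ae_summable_dissipation, ae_restrict_mem measurableSet_Ioi] with s hs hs0
    have hs1 := h.sq_summable s (le_of_lt hs0)
    rw [dissipation, ← hs1.sum_add_tsum_compl (s := S), ← hs.sum_add_tsum_compl (s := S),
      add_sub_cancel_left, add_sub_cancel_left, ← tsum_mul_left]
    refine ((hs1.subtype _).mul_left _).tsum_le_tsum (fun n => ?_) (hs.subtype _)
    have hn : (n : ℤ) ∉ S := n.2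
    simp only [hS, Finset.mem_Icc, not_and_or, not_le] at hn
    gcongr ?_ * _
    gcongr κ ^ 2 + ?_
    have : ((m : ℤ) + 1) ^ 2 ≤ (n : ℤ) ^ 2 := by
      rcases hn with hn | hn <;> nlinarith
    exact_mod_cast this
  -- `high - low = total - 2 low` satisfies `V' ≤ -α V`, so the cone `V ≤ 0` is invariant
  have hV : IsPrimitive (fun s => ∑' n, ‖a n s‖ ^ 2 + -2 * ∑ n ∈ S, ‖a n s‖ ^ 2)
      (fun s => -2 * dissipation κ a s + -2 *
        (-2 * ∑ n ∈ S, (κ ^ 2 + (n : ℝ) ^ 2) * ‖a n s‖ ^ 2 + 2 * flux κ a u S s)) :=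
    h.energy.add ((h.isPrimitive_sum S).const_mul (-2))
  have hcone : ∀ s, 0 ≤ s → ∑' n, ‖a n s‖ ^ 2 ≤ 2 * ∑ n ∈ S, ‖a n s‖ ^ 2 := by
    intro s hs
    have := hV.le_mul_exp (c := -α) ?_ hs
    · have h2 := mul_nonpos_of_nonpos_of_nonneg
        (show ∑' n, ‖a n 0‖ ^ 2 + -2 * ∑ n ∈ S, ‖a n 0‖ ^ 2 ≤ 0 by linarith)
        (Real.exp_pos (-α * s)).le
      linarith
    · filter_upwards [hflux, hhigh, ae_restrict_mem measurableSet_Ioi] with r hr1 hr2 hr0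
      have hr3 := hlow r
      have hle : ∑ n ∈ S, ‖a n r‖ ^ 2 ≤ ∑' n, ‖a n r‖ ^ 2 :=
        (h.sq_summable r (le_of_lt hr0)).sum_le_tsum _ fun n _ => by positivity
      have := neg_abs_le (flux κ a u S r)
      rw [hα]
      nlinarith [mul_nonneg (sub_nonneg.2 hgap) (sub_nonneg.2 hle)]
  have hL := ((h.isPrimitive_sum S).const_mul (-1)).le_mul_exp (c := -α) ?_ ht
  · linarith
  · filter_upwards [hflux, ae_restrict_mem measurableSet_Ioi] with r hr1 hr0
    have hr3 := hlow r
    have hc := hcone r (le_of_lt hr0)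
    have := neg_abs_le (flux κ a u S r)
    have hβ0 : 0 ≤ β := mul_nonneg (mul_nonneg (abs_nonneg _) h.nonneg) (Real.sqrt_nonneg _)
    rw [hα]
    nlinarith [mul_le_mul_of_nonneg_left hc hβ0]

/-- Any finite part of the initial energy gives a lower bound for the energy with an exponential
rate that depends only on the initial data and on the size of the shear. -/
theorem exists_exp_lower_bound (κ M : ℝ) {b : ℤ → ℂ} (hb : Summable fun n => ‖b n‖ ^ 2)
    (T : Finset ℤ) :
    ∃ β : ℝ, ∀ a u : ℤ → ℝ → ℂ, ModeSystem κ M a u → (∀ n, a n 0 = b n) → ∀ t, 0 ≤ t →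
      (∑ n ∈ T, ‖b n‖ ^ 2) * Real.exp (-β * t) ≤ ∑' n, ‖a n t‖ ^ 2 := by
  obtain ⟨m, hm1, hm2, hm3⟩ : ∃ m : ℕ, 2 * (|κ| * M) ≤ √(2 * m + 1) ∧
      T ⊆ Finset.Icc (-(m : ℤ)) m ∧
      ∑' n, ‖b n‖ ^ 2 ≤ 2 * ∑ n ∈ Finset.Icc (-(m : ℤ)) m, ‖b n‖ ^ 2 := by
    have h1 : ∀ᶠ m : ℕ in atTop, 2 * (|κ| * M) ≤ √(2 * m + 1) := by
      refine (Real.tendsto_sqrt_atTop.comp ?_).eventually_ge_atTop _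
      exact tendsto_atTop_add_const_right _ _
        ((tendsto_natCast_atTop_atTop (R := ℝ)).const_mul_atTop two_pos)
    have h2 : ∀ᶠ m : ℕ in atTop, T ⊆ Finset.Icc (-(m : ℤ)) m :=
      Finset.tendsto_Icc_neg.eventually (eventually_ge_atTop T)
    have h3 : ∀ᶠ m : ℕ in atTop,
        ∑' n, ‖b n‖ ^ 2 ≤ 2 * ∑ n ∈ Finset.Icc (-(m : ℤ)) m, ‖b n‖ ^ 2 := by
      rcases (tsum_nonneg fun n => sq_nonneg ‖b n‖ : 0 ≤ ∑' n, ‖b n‖ ^ 2).eq_or_lt with h | h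
      · rw [← h]
        exact Eventually.of_forall fun m => by positivity
      · have := ((tendsto_sum_Icc hb).const_mul 2).eventually (lt_mem_nhds
          (show ∑' n, ‖b n‖ ^ 2 < 2 * ∑' n, ‖b n‖ ^ 2 by linarith))
        exact this.mono fun m hm => hm.le
    obtain ⟨m, hm1, hm2, hm3⟩ := (h1.and (h2.and h3)).exists
    exact ⟨m, hm1, hm2, hm3⟩
  refine ⟨2 * κ ^ 2 + 2 * m ^ 2 + 2 * (|κ| * M * √(2 * m + 1)), fun a u h hab t ht => ?_⟩
  have h1 := h.low_frequency_lower_bound m hm1 (by simpa only [hab] using hm3) ht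
  simp only [hab] at h1
  calc (∑ n ∈ T, ‖b n‖ ^ 2) * _ ≤ (∑ n ∈ Finset.Icc (-(m : ℤ)) m, ‖b n‖ ^ 2) * _ := by
        gcongr
    _ ≤ ∑ n ∈ Finset.Icc (-(m : ℤ)) m, ‖a n t‖ ^ 2 := h1
    _ ≤ _ := (h.sq_summable t ht).sum_le_tsum _ fun n _ => by positivity

/-- For initial data in `H¹` the energy decreases at most linearly in time. Pairing the solution
with its initial value shows that the loss of energy `d` satisfies `d / 2 ≤ ∫ C √(G D)`, where `D`
is the dissipation rate, and `∫ D = d / 2`. -/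
theorem energy_loss_le (h : ModeSystem κ M a u)
    (hG : Summable fun n : ℤ => (1 + κ ^ 2 + (n : ℝ) ^ 2) * ‖a n 0‖ ^ 2) {t : ℝ} (ht : 0 ≤ t) :
    ∑' n, ‖a n 0‖ ^ 2 - ∑' n, ‖a n t‖ ^ 2 ≤ 2 * t * ((1 + M * wienerConst) ^ 2 *
      ∑' n : ℤ, (1 + κ ^ 2 + (n : ℝ) ^ 2) * ‖a n 0‖ ^ 2) := by
  set G := ∑' n : ℤ, (1 + κ ^ 2 + (n : ℝ) ^ 2) * ‖a n 0‖ ^ 2 with hGdef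
  set C := 1 + M * wienerConst with hC
  have hG0 : 0 ≤ G := tsum_nonneg fun n => by positivity
  have hE := h.energy.2 t ht
  rw [intervalIntegral.integral_const_mul] at hE
  have hDint : IntervalIntegrable (dissipation κ a) volume 0 t := by
    have := (h.energy.1 t ht).const_mul (-1 / 2)
    refine this.congr fun s _ => ?_
    ring
  have hfin : ∀ S : Finset ℤ, ∑ n ∈ S, ‖a n 0‖ ^ 2 - ∑ n ∈ S, ‖a n t‖ ^ 2 ≤
      (∫ s in (0:ℝ)..t, dissipation κ a s) + t * (C ^ 2 * G) := by
    intro S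
    have hP := IsPrimitive.sum S fun n _ => (h.evolution n).clm
      (Complex.reCLM.comp (ContinuousLinearMap.mul ℝ ℂ (star (a n 0))))
    have hbound : ∀ᵐ s ∂(volume.restrict (Ioi (0 : ℝ))),
        -(1 / 2 * dissipation κ a s + 1 / 2 * (C ^ 2 * G)) ≤
        ∑ n ∈ S, (Complex.reCLM.comp (ContinuousLinearMap.mul ℝ ℂ (star (a n 0))))
          (-((κ ^ 2 + (n : ℝ) ^ 2 : ℝ) : ℂ) * a n s
            + -(Complex.I * κ) * ∑' p, u (n - p) s * a p s) := by
      filter_upwards [h.ae_summable_dissipation, h.shear_bound,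
        ae_restrict_mem measurableSet_Ioi] with s hD hu hs0
      have hs := h.sq_summable s (le_of_lt hs0)
      have hD0 : 0 ≤ dissipation κ a s := tsum_nonneg fun n => by positivity
      have hκF : |κ| * √(∑' n, ‖a n s‖ ^ 2) ≤ √(dissipation κ a s) := by
        rw [← Real.sqrt_sq_eq_abs, ← Real.sqrt_mul (sq_nonneg κ), ← tsum_mul_left]
        refine Real.sqrt_le_sqrt ((hs.mul_left _).tsum_le_tsum (fun n => ?_) hD)
        gcongr
        nlinarith [sq_nonneg (n : ℝ)]
      have h1 : ∑ n ∈ S, (κ ^ 2 + (n : ℝ) ^ 2) * ‖a n 0‖ * ‖a n s‖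
          ≤ √G * √(dissipation κ a s) := by
        calc _ = ∑ n ∈ S, (√(κ ^ 2 + (n : ℝ) ^ 2) * ‖a n 0‖) *
              (√(κ ^ 2 + (n : ℝ) ^ 2) * ‖a n s‖) := by
              refine Finset.sum_congr rfl fun n _ => ?_
              have := Real.mul_self_sqrt (show 0 ≤ κ ^ 2 + (n : ℝ) ^ 2 by positivity)
              linear_combination (-‖a n 0‖ * ‖a n s‖) * this
          _ ≤ _ := Real.sum_mul_le_sqrt_mul_sqrt _ _ _
          _ ≤ _ := by
              gcongr
              · refine le_trans (Finset.sum_le_sum fun n _ => ?_)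
                  (hG.sum_le_tsum S fun n _ => by positivity)
                rw [mul_pow, Real.sq_sqrt (by positivity)]
                gcongr
                linarith
              · refine le_trans (Finset.sum_le_sum fun n _ => ?_)
                  (hD.sum_le_tsum S fun n _ => by positivity)
                rw [mul_pow, Real.sq_sqrt (by positivity)]
      have h2 : ∑ n ∈ S, ‖a n 0‖ * (|κ| * (M * √(∑' n, ‖a n s‖ ^ 2)))
          ≤ M * wienerConst * (√G * √(dissipation κ a s)) := by
        rw [← Finset.sum_mul]
        have hM := h.nonneg
        have hw := wienerConst_nonneg
        calc _ ≤ (wienerConst * √G) * (M * √(dissipation κ a s)) := by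
              refine mul_le_mul (sum_norm_le_wienerConst hG S) ?_ (by positivity) (by positivity)
              calc _ = M * (|κ| * √(∑' n, ‖a n s‖ ^ 2)) := by ring
                _ ≤ _ := by gcongr
          _ = _ := by ring
      -- Young's inequality, with weights such that half of `∫ D` can be absorbed at the end
      have h3 : C * (√G * √(dissipation κ a s))
          ≤ 1 / 2 * dissipation κ a s + 1 / 2 * (C ^ 2 * G) := by
        have := two_mul_le_add_sq (C * √G) (√(dissipation κ a s))
        rw [mul_pow, Real.sq_sqrt hG0, Real.sq_sqrt hD0] at this
        linarith
      have h4 : ∑ n ∈ S, ((κ ^ 2 + (n : ℝ) ^ 2) * ‖a n 0‖ * ‖a n s‖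
          + ‖a n 0‖ * (|κ| * (M * √(∑' n, ‖a n s‖ ^ 2)))) ≤ C * (√G * √(dissipation κ a s)) := by
        rw [Finset.sum_add_distrib, hC]
        linarith
      refine (neg_le_neg (h4.trans h3)).trans ?_
      rw [← Finset.sum_neg_distrib]
      refine Finset.sum_le_sum fun n _ => ?_
      refine neg_le_of_abs_le ((Complex.abs_re_le_norm _).trans ?_)
      change ‖star (a n 0) * (-((κ ^ 2 + (n : ℝ) ^ 2 : ℝ) : ℂ) * a n s
        + -(Complex.I * κ) * ∑' p, u (n - p) s * a p s)‖ ≤ _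
      rw [mul_add]
      refine (norm_add_le _ _).trans (add_le_add (le_of_eq ?_) ?_)
      · rw [norm_mul, norm_mul, norm_star, norm_neg, Complex.norm_real,
          Real.norm_of_nonneg (by positivity)]
        ring
      · rw [norm_mul, norm_star, norm_mul, norm_neg, norm_mul, Complex.norm_I, one_mul,
          Complex.norm_real, Real.norm_eq_abs]
        gcongr
        exact (convolution_bound h.nonneg hu.1 hu.2 hs n).2
    have hmono : -(1 / 2 * (∫ s in (0:ℝ)..t, dissipation κ a s) + t * (1 / 2 * (C ^ 2 * G))) ≤
        ∫ s in (0:ℝ)..t, ∑ n ∈ S, (Complex.reCLM.comp (ContinuousLinearMap.mul ℝ ℂ (star (a n 0))))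
          (-((κ ^ 2 + (n : ℝ) ^ 2 : ℝ) : ℂ) * a n s
            + -(Complex.I * κ) * ∑' p, u (n - p) s * a p s) := by
      have hi : IntervalIntegrable (fun s => 1 / 2 * dissipation κ a s + 1 / 2 * (C ^ 2 * G))
        volume 0 t := (hDint.const_mul _).add intervalIntegrable_const
      calc _ = ∫ s in (0:ℝ)..t, -(1 / 2 * dissipation κ a s + 1 / 2 * (C ^ 2 * G)) := by
            rw [intervalIntegral.integral_neg, intervalIntegral.integral_add
              (hDint.const_mul _) intervalIntegrable_const, intervalIntegral.integral_const_mul,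
              intervalIntegral.integral_const, sub_zero, smul_eq_mul]
        _ ≤ _ := intervalIntegral.integral_mono_ae_restrict ht hi.neg (hP.1 t ht) (by
            rw [MeasureTheory.Measure.restrict_congr_set Ioc_ae_eq_Icc.symm]
            exact ae_restrict_of_ae_restrict_of_subset Ioc_subset_Ioi_self hbound)
    have hPt := hP.2 t ht
    have hst : ∑ n ∈ S, (Complex.reCLM.comp (ContinuousLinearMap.mul ℝ ℂ (star (a n 0)))) (a n t)
        ≤ 1 / 2 * ∑ n ∈ S, ‖a n 0‖ ^ 2 + 1 / 2 * ∑ n ∈ S, ‖a n t‖ ^ 2 := by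
      rw [Finset.mul_sum, Finset.mul_sum, ← Finset.sum_add_distrib]
      refine Finset.sum_le_sum fun n _ => ?_
      refine (Complex.re_le_norm _).trans ?_
      change ‖star (a n 0) * a n t‖ ≤ _
      rw [norm_mul, norm_star]
      linarith [two_mul_le_add_sq ‖a n 0‖ ‖a n t‖]
    have hs0 : ∑ n ∈ S, (Complex.reCLM.comp (ContinuousLinearMap.mul ℝ ℂ (star (a n 0)))) (a n 0)
        = ∑ n ∈ S, ‖a n 0‖ ^ 2 := by
      refine Finset.sum_congr rfl fun n _ => ?_
      have : star (a n 0) * a n 0 = ((‖a n 0‖ ^ 2 : ℝ) : ℂ) := by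
        rw [← Complex.normSq_eq_norm_sq]; exact Complex.normSq_eq_conj_mul_self.symm
      rw [ContinuousLinearMap.comp_apply, ContinuousLinearMap.mul_apply', this]
      exact Complex.ofReal_re _
    linarith
  have hlim := le_of_tendsto' ((tendsto_sum_Icc (h.sq_summable 0 le_rfl)).sub
    (tendsto_sum_Icc (h.sq_summable t ht))) fun N => hfin _
  linarith

end ModeSystem

/-! ### Fourier series on the torus -/

/-- The character `(x, y) ↦ exp (i (k x + n y))`, for `p = (k, n)`. -/
def torusChar (p : ℤ × ℤ) : C(Torus2, ℂ) where
  toFun z := fourier p.1 z.1 * fourier p.2 z.2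
  continuous_toFun := by fun_prop

theorem torusChar_apply (p : ℤ × ℤ) (z : Torus2) :
    torusChar p z = fourier p.1 z.1 * fourier p.2 z.2 := rfl

theorem torusChar_add (p q : ℤ × ℤ) (z : Torus2) :
    torusChar (p + q) z = torusChar p z * torusChar q z := by
  simp only [torusChar_apply, Prod.fst_add, Prod.snd_add, fourier_add]
  ring

theorem torusChar_neg (p : ℤ × ℤ) (z : Torus2) : torusChar (-p) z = conj (torusChar p z) := by
  simp only [torusChar_apply, Prod.fst_neg, Prod.snd_neg, fourier_neg, map_mul]

theorem norm_torusChar (p : ℤ × ℤ) (z : Torus2) : ‖torusChar p z‖ = 1 := by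
  have h : ∀ (n : ℤ) (x : Tor), ‖(fourier n x : ℂ)‖ = 1 := fun n x =>
    Circle.norm_coe (AddCircle.toCircle (n • x))
  rw [torusChar_apply, norm_mul, h, h, mul_one]

theorem integral_fourier (n : ℤ) :
    ∫ x : Tor, (fourier n x : ℂ) = if n = 0 then (2 * π : ℂ) else 0 := by
  have h := congrFun (fourierCoeff_fourier (T := 2 * π) n) 0
  rw [fourierCoeff, AddCircle.integral_haarAddCircle] at h
  simp only [neg_zero, fourier_zero, one_smul] at h
  have h2 : ∫ x : Tor, (fourier n x : ℂ) = (2 * π) • (Pi.single n (1:ℂ) : ℤ → ℂ) 0 := by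
    rw [← h, smul_inv_smul₀ Real.two_pi_pos.ne']
  rw [h2]
  by_cases hn : n = 0
  · subst hn; simp
  · simp [hn]

theorem integral_torusChar (p : ℤ × ℤ) :
    ∫ z, torusChar p z = if p = 0 then ((2 * π) ^ 2 : ℂ) else 0 := by
  simp only [torusChar_apply]
  rw [Measure.volume_eq_prod, integral_prod_mul (fun x : Tor => (fourier p.1 x : ℂ))
    (fun y : Tor => (fourier p.2 y : ℂ)), integral_fourier, integral_fourier]
  by_cases h1 : p.1 = 0 <;> by_cases h2 : p.2 = 0 <;> simp [h1, h2, Prod.ext_iff, sq]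

theorem conj_two_pi_inv : conj (2 * π : ℂ)⁻¹ = (2 * π : ℂ)⁻¹ := by
  rw [map_inv₀]
  congr 1
  exact_mod_cast Complex.conj_ofReal (2 * π)

/-- The normalized characters, as elements of `L²(𝕋²; ℂ)`. -/
def torusCharLp (p : ℤ × ℤ) : Lp ℂ 2 (volume : Measure Torus2) :=
  ((2 * π : ℂ)⁻¹) • ContinuousMap.toLp 2 volume ℂ (torusChar p)

theorem orthonormal_torusCharLp : Orthonormal ℂ torusCharLp := by
  rw [orthonormal_iff_ite]
  intro p q
  rw [torusCharLp, torusCharLp, inner_smul_left, inner_smul_right, ContinuousMap.inner_toLp]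
  have : ∫ z, torusChar q z * conj (torusChar p z)
      = if p = q then ((2 * π) ^ 2 : ℂ) else 0 := by
    simp only [← torusChar_neg, ← torusChar_add, integral_torusChar]
    refine if_congr ?_ rfl rfl
    rw [add_neg_eq_zero, eq_comm]
  have hpi : (2 * π : ℂ) ≠ 0 := by exact_mod_cast Real.two_pi_pos.ne'
  rw [this, conj_two_pi_inv]
  split_ifs
  · field_simp
  · simp

theorem torusChar_span_closure :
    (Submodule.span ℂ (range torusChar)).topologicalClosure = ⊤ := by
  let A : StarSubalgebra ℂ C(Torus2, ℂ) :=
    { toSubalgebra := Algebra.adjoin ℂ (range torusChar)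
      star_mem' := by
        change Algebra.adjoin ℂ (range torusChar) ≤ star (Algebra.adjoin ℂ (range torusChar))
        refine Algebra.adjoin_le ?_
        rintro _ ⟨p, rfl⟩
        refine Algebra.subset_adjoin ⟨-p, ?_⟩
        ext1 z
        exact torusChar_neg p z }
  have hA : A.toSubalgebra.toSubmodule = Submodule.span ℂ (range torusChar) := by
    refine Algebra.adjoin_eq_span_of_subset ℂ (.trans (fun f => Submonoid.closure_induction
      (fun _ => id) ⟨0, ?_⟩ ?_) Submodule.subset_span)
    · ext z
      simp [torusChar_apply]
    · rintro _ _ _ _ ⟨p, rfl⟩ ⟨q, rfl⟩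
      exact ⟨p + q, by ext z; exact torusChar_add p q z⟩
  have hsep : A.SeparatesPoints := by
    intro z w hzw
    have hinj : ∀ x y : Tor, x ≠ y → (fourier 1 x : ℂ) ≠ fourier 1 y := fun x y hxy h => by
      rw [fourier_one, fourier_one] at h
      exact hxy (AddCircle.injective_toCircle Real.two_pi_pos.ne' (Circle.ext h))
    by_cases h1 : z.1 = w.1
    · have h2 : z.2 ≠ w.2 := fun h2 => hzw (Prod.ext h1 h2)
      refine ⟨_, ⟨torusChar (0, 1), Algebra.subset_adjoin ⟨(0, 1), rfl⟩, rfl⟩, ?_⟩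
      simpa [torusChar_apply] using hinj _ _ h2
    · refine ⟨_, ⟨torusChar (1, 0), Algebra.subset_adjoin ⟨(1, 0), rfl⟩, rfl⟩, ?_⟩
      simpa [torusChar_apply] using hinj _ _ h1
  rw [← hA]
  exact congr_arg (Subalgebra.toSubmodule <| StarSubalgebra.toSubalgebra ·)
    (ContinuousMap.starSubalgebra_topologicalClosure_eq_top_of_separatesPoints A hsep)

theorem torusCharLp_span_closure :
    (Submodule.span ℂ (range torusCharLp)).topologicalClosure = ⊤ := by
  have h1 : (Submodule.span ℂ (range fun p => ContinuousMap.toLp (E := ℂ) 2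
      (volume : Measure Torus2) ℂ (torusChar p))).topologicalClosure = ⊤ := by
    simpa only [Submodule.map_span, ContinuousLinearMap.coe_coe, ← range_comp,
      Function.comp_def] using
      (ContinuousMap.toLp_denseRange ℂ (volume : Measure Torus2) ℂ
        (ENNReal.ofNat_ne_top (n := 2))).topologicalClosure_map_submodule torusChar_span_closure
  refine top_le_iff.1 (h1.ge.trans (Submodule.topologicalClosure_mono (Submodule.span_le.2 ?_)))
  rintro _ ⟨p, rfl⟩
  have hpi : (2 * π : ℂ) ≠ 0 := by exact_mod_cast Real.two_pi_pos.ne'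
  have : ContinuousMap.toLp (E := ℂ) 2 (volume : Measure Torus2) ℂ (torusChar p)
      = (2 * π : ℂ) • torusCharLp p := by
    rw [torusCharLp, smul_inv_smul₀ hpi]
  simp only [this]
  exact Submodule.smul_mem _ _ (Submodule.subset_span ⟨p, rfl⟩)

/-- The Fourier basis of `L²(𝕋²; ℂ)`. -/
def torusBasis : HilbertBasis (ℤ × ℤ) ℂ (Lp ℂ 2 (volume : Measure Torus2)) :=
  HilbertBasis.mk orthonormal_torusCharLp torusCharLp_span_closure.ge

theorem torusBasis_apply (p : ℤ × ℤ) : torusBasis p = torusCharLp p := by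
  rw [torusBasis, HilbertBasis.coe_mk]

theorem coeFn_torusBasis (p : ℤ × ℤ) :
    torusBasis p =ᵐ[volume] fun z => (2 * π : ℂ)⁻¹ * torusChar p z := by
  rw [torusBasis_apply, torusCharLp]
  filter_upwards [Lp.coeFn_smul ((2 * π : ℂ)⁻¹)
    (ContinuousMap.toLp (E := ℂ) 2 (volume : Measure Torus2) ℂ (torusChar p)),
    ContinuousMap.coeFn_toLp (p := 2) (𝕜 := ℂ) (volume : Measure Torus2) (torusChar p)] with z h1 h2
  rw [h1, Pi.smul_apply, h2, smul_eq_mul]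

/-- The complexification of a real-valued element of `L²(𝕋²)`. -/
def toComplexLp : L2Torus →L[ℝ] Lp ℂ 2 (volume : Measure Torus2) :=
  Complex.ofRealCLM.compLpL 2 volume

theorem coeFn_toComplexLp (f : L2Torus) :
    toComplexLp f =ᵐ[volume] fun z => ((f z : ℝ) : ℂ) :=
  ContinuousLinearMap.coeFn_compLpL (p := 2) (μ := (volume : Measure Torus2)) Complex.ofRealCLM f

theorem norm_toComplexLp (f : L2Torus) : ‖toComplexLp f‖ = ‖f‖ := by
  rw [Lp.norm_def, Lp.norm_def]
  congr 1
  refine eLpNorm_congr_norm_ae ?_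
  filter_upwards [coeFn_toComplexLp f] with z hz
  rw [hz, Complex.norm_real]

/-- The Fourier coefficients of a real-valued element of `L²(𝕋²)`, with respect to the orthonormal
basis `(2π)⁻¹ exp (i (k x + n y))`. -/
def torusCoeff (f : L2Torus) (p : ℤ × ℤ) : ℂ := inner ℂ (torusBasis p) (toComplexLp f)

theorem torusCoeff_eq_integral (f : L2Torus) (p : ℤ × ℤ) :
    torusCoeff f p = (2 * π : ℂ)⁻¹ * ∫ z, (f z : ℂ) * torusChar (-p) z := by
  rw [torusCoeff, L2.inner_def, ← integral_const_mul]
  refine integral_congr_ae ?_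
  filter_upwards [coeFn_torusBasis p, coeFn_toComplexLp f] with z h1 h2
  rw [h1, h2, RCLike.inner_apply, torusChar_neg, map_mul, conj_two_pi_inv]
  ring

theorem continuous_torusCoeff (p : ℤ × ℤ) : Continuous fun f => torusCoeff f p :=
  (innerSL ℂ (torusBasis p)).continuous.comp toComplexLp.continuous

/-- **Parseval's identity** on the torus. -/
theorem hasSum_sq_torusCoeff (f : L2Torus) :
    HasSum (fun p => ‖torusCoeff f p‖ ^ 2) (‖f‖ ^ 2) := by
  have := torusBasis.hasSum_inner_mul_inner (toComplexLp f) (toComplexLp f)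
  rw [inner_self_eq_norm_sq_to_K, norm_toComplexLp] at this
  have h2 := RCLike.hasSum_re ℂ this
  convert! h2 using 1
  · ext p
    rw [← inner_conj_symm (𝕜 := ℂ) (toComplexLp f) (torusBasis p), ← torusCoeff]
    rw [RCLike.conj_mul]
    norm_cast
  · norm_cast

theorem integrable_mul_torusChar (f : L2Torus) (p : ℤ × ℤ) :
    Integrable fun z => (f z : ℂ) * torusChar p z := by
  have hf : Integrable fun z => (f z : ℂ) :=
    ((Lp.memLp f).integrable (by norm_num)).ofReal
  exact hf.mul_bdd (c := 1) (torusChar p).continuous.aestronglyMeasurable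
    (ae_of_all _ fun z => (norm_torusChar p z).le)

/-! ### Fourier coefficients of the shear profile -/

theorem memLp_ofReal {V : Tor → ℝ} (hV : MemLp V 2) : MemLp (fun y => (V y : ℂ)) 2 :=
  hV.ofReal

theorem hasSum_sq_fourierCoeff_ofReal {V : Tor → ℝ} (hV : MemLp V 2) :
    (Summable fun j => ‖fourierCoeff (fun y => (V y : ℂ)) j‖ ^ 2) ∧
      ∑' j, ‖fourierCoeff (fun y => (V y : ℂ)) j‖ ^ 2 ≤ (eLpNorm V 2 volume).toReal ^ 2 := by
  have hVh := (memLp_ofReal hV).haarAddCircle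
  have h := hasSum_sq_fourierCoeff (hVh.toLp _)
  have hc : ∀ j, fourierCoeff (hVh.toLp _) j = fourierCoeff (fun y => (V y : ℂ)) j := fun j =>
    congrFun (fourierCoeff_congr_ae hVh.coeFn_toLp) j
  simp only [hc] at h
  refine ⟨h.summable, h.tsum_eq.trans_le ?_⟩
  have h1 : ∫ y, ‖(hVh.toLp _) y‖ ^ 2 ∂AddCircle.haarAddCircle = (2 * π)⁻¹ * ∫ y, ‖V y‖ ^ 2 := by
    have he := AddCircle.integral_haarAddCircle (T := 2 * π) (f := fun y => ‖V y‖ ^ 2)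
    rw [smul_eq_mul] at he
    rw [← he]
    refine integral_congr_ae ?_
    filter_upwards [hVh.coeFn_toLp] with y hy
    rw [hy, Complex.norm_real]
  have h2 : ∫ y, ‖V y‖ ^ 2 = (eLpNorm V 2 volume).toReal ^ 2 := by
    rw [hV.eLpNorm_eq_integral_rpow_norm two_ne_zero ENNReal.ofNat_ne_top,
      ENNReal.toReal_ofReal (by positivity)]
    simp only [ENNReal.toReal_ofNat, Real.rpow_ofNat]
    rw [← Real.rpow_natCast, ← Real.rpow_mul (integral_nonneg fun y => by positivity)]
    norm_num
  rw [h1, h2]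
  refine mul_le_of_le_one_left (by positivity) (inv_le_one_of_one_le₀ ?_)
  linarith [Real.pi_gt_three]

theorem fourierCoeff_ofReal_neg (V : Tor → ℝ) (j : ℤ) :
    fourierCoeff (fun y => (V y : ℂ)) (-j) = star (fourierCoeff (fun y => (V y : ℂ)) j) := by
  rw [fourierCoeff, fourierCoeff, ← starRingEnd_apply, ← integral_conj]
  refine integral_congr_ae (ae_of_all _ fun y => ?_)
  simp only [smul_eq_mul, map_mul, ← fourier_neg, Complex.conj_ofReal]

/-- Multiplication by a function of `y` acts on the Fourier coefficients by convolution in the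
second index. -/
theorem hasSum_convolution {V : Tor → ℝ} (hV : MemLp V 2) (f : L2Torus) (k n : ℤ) :
    HasSum (fun p => fourierCoeff (fun y => (V y : ℂ)) (n - p) * torusCoeff f (k, p))
      ((2 * π : ℂ)⁻¹ * ∫ z, (f z : ℂ) * V z.2 * torusChar (-(k, n)) z) := by
  have hVz : MemLp (fun z : Torus2 => (V z.2 : ℂ)) 2 volume :=
    (memLp_ofReal hV).comp_snd (volume : Measure Tor)
  have hh : MemLp (fun z : Torus2 => (V z.2 : ℂ) * torusChar (k, n) z) 2 volume := by
    refine hVz.of_le (hVz.1.mul (torusChar (k, n)).continuous.aestronglyMeasurable)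
      (ae_of_all _ fun z => ?_)
    rw [norm_mul, norm_torusChar, mul_one]
  have hpi : (2 * π : ℂ) ≠ 0 := by exact_mod_cast Real.two_pi_pos.ne'
  have key := torusBasis.hasSum_inner_mul_inner (hh.toLp _) (toComplexLp f)
  have h1 : inner ℂ (hh.toLp _) (toComplexLp f) = ∫ z, (f z : ℂ) * V z.2 * torusChar (-(k, n)) z := by
    rw [L2.inner_def]
    refine integral_congr_ae ?_
    filter_upwards [hh.coeFn_toLp, coeFn_toComplexLp f] with z hz1 hz2
    rw [hz1, hz2, RCLike.inner_apply, map_mul, Complex.conj_ofReal, torusChar_neg]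
    ring
  have h2 : ∀ q : ℤ × ℤ, inner ℂ (hh.toLp _) (torusBasis q)
      = if q.1 = k then (2 * π : ℂ) * fourierCoeff (fun y => (V y : ℂ)) (n - q.2) else 0 := by
    intro q
    have : inner ℂ (hh.toLp _) (torusBasis q) = (2 * π : ℂ)⁻¹ *
        ∫ z : Torus2, (fourier (q.1 - k) z.1 : ℂ) * (fourier (-(n - q.2)) z.2 * (V z.2 : ℂ)) := by
      rw [L2.inner_def, ← integral_const_mul]
      refine integral_congr_ae ?_
      filter_upwards [hh.coeFn_toLp, coeFn_torusBasis q] with z hz1 hz2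
      rw [hz1, hz2, RCLike.inner_apply, map_mul, Complex.conj_ofReal, ← torusChar_neg,
        torusChar_apply, torusChar_apply, sub_eq_add_neg q.1, fourier_add, neg_sub,
        sub_eq_add_neg q.2, fourier_add]
      simp only [Prod.fst_neg, Prod.snd_neg]
      ring
    rw [this, Measure.volume_eq_prod, integral_prod_mul
      (fun x : Tor => (fourier (q.1 - k) x : ℂ))
      (fun y : Tor => (fourier (-(n - q.2)) y * (V y : ℂ))), integral_fourier]
    simp only [sub_eq_zero]
    split_ifs with hq
    · rw [fourierCoeff, AddCircle.integral_haarAddCircle, Complex.real_smul]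
      simp only [smul_eq_mul]
      push_cast
      field_simp
    · simp
  rw [h1] at key
  simp only [h2] at key
  have hinj : Function.Injective fun p : ℤ => (k, p) := fun p q h => (Prod.ext_iff.1 h).2
  have h3 := (hinj.hasSum_iff (f := fun q : ℤ × ℤ => (if q.1 = k then (2 * π : ℂ) *
      fourierCoeff (fun y => (V y : ℂ)) (n - q.2) else 0) * inner ℂ (torusBasis q) (toComplexLp f))
    (fun q hq => ?_)).2 key
  · have h4 := h3.mul_left (2 * π : ℂ)⁻¹
    refine h4.congr_fun ?_
    intro p
    simp only [Function.comp, if_true, torusCoeff]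
    field_simp
  · have : q.1 ≠ k := fun h => hq ⟨q.2, by rw [← h]⟩
    simp [this]

/-! ### Trigonometric test functions -/

/-- The trigonometric polynomial `Re (c exp (i (k x + n y)))`, for `p = (k, n)`. -/
def trigPoly (c : ℂ) (p : ℤ × ℤ) (z : Torus2) : ℝ := (c * torusChar p z).re

theorem hasDerivAt_fourier_add (n : ℤ) (x : Tor) :
    HasDerivAt (fun s : ℝ => (fourier n (x + (s : Tor)) : ℂ)) (Complex.I * n * fourier n x) 0 := by
  induction x using QuotientAddGroup.induction_on with
  | H r =>
    have h := (hasDerivAt_fourier (2 * π) n (r + 0)).comp_const_add r 0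
    have hpi : (2 * π : ℂ) ≠ 0 := by exact_mod_cast Real.two_pi_pos.ne'
    convert! h using 1
    rw [add_zero]
    push_cast
    field_simp

theorem partialX_trigPoly (c : ℂ) (p : ℤ × ℤ) :
    partialX (trigPoly c p) = trigPoly (Complex.I * p.1 * c) p := by
  funext z
  have h := (((hasDerivAt_fourier_add p.1 z.1).mul_const (fourier p.2 z.2 : ℂ)).const_mul c)
  have h2 := (Complex.reCLM.hasFDerivAt.comp_hasDerivAt _ h).deriv
  refine h2.trans ?_
  simp only [trigPoly, torusChar_apply, Complex.reCLM_apply]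
  congr 1
  ring

theorem partialY_trigPoly (c : ℂ) (p : ℤ × ℤ) :
    partialY (trigPoly c p) = trigPoly (Complex.I * p.2 * c) p := by
  funext z
  have h := (((hasDerivAt_fourier_add p.2 z.2).const_mul (fourier p.1 z.1 : ℂ)).const_mul c)
  have h2 := (Complex.reCLM.hasFDerivAt.comp_hasDerivAt _ h).deriv
  refine h2.trans ?_
  simp only [trigPoly, torusChar_apply, Complex.reCLM_apply]
  congr 1
  ring

theorem laplacianT_trigPoly (c : ℂ) (p : ℤ × ℤ) (z : Torus2) :
    laplacianT (trigPoly c p) z = trigPoly (-(p.1 ^ 2 + p.2 ^ 2) * c) p z := by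
  rw [laplacianT, partialX_trigPoly, partialX_trigPoly, partialY_trigPoly, partialY_trigPoly]
  simp only [trigPoly, ← Complex.add_re]
  congr 1
  linear_combination ((p.1 : ℂ) ^ 2 + (p.2 : ℂ) ^ 2) * c * torusChar p z * Complex.I_sq

theorem contDiff_torusChar (p : ℤ × ℤ) :
    ContDiff ℝ ∞ fun q : ℝ × ℝ => torusChar p ((q.1 : Tor), (q.2 : Tor)) := by
  simp only [torusChar_apply, fourier_coe_apply]
  have h1 : ContDiff ℝ ∞ fun q : ℝ × ℝ => (q.1 : ℂ) := Complex.ofRealCLM.contDiff.comp contDiff_fst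
  have h2 : ContDiff ℝ ∞ fun q : ℝ × ℝ => (q.2 : ℂ) := Complex.ofRealCLM.contDiff.comp contDiff_snd
  exact ((contDiff_const.mul h1).div_const _).cexp.mul ((contDiff_const.mul h2).div_const _).cexp

theorem smoothOnTorus_trigPoly (c : ℂ) (p : ℤ × ℤ) : SmoothOnTorus (trigPoly c p) :=
  Complex.reCLM.contDiff.comp (contDiff_const.mul (contDiff_torusChar p))

theorem isTestFunction_trigPoly {η : ℝ → ℝ} (hη : ContDiff ℝ ∞ η)
    (hsupp : ∃ a b : ℝ, 0 < a ∧ a < b ∧ ∀ t, t ∉ Icc a b → η t = 0) (c : ℂ) (p : ℤ × ℤ) :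
    IsTestFunction fun t => trigPoly (η t * c) p := by
  refine ⟨?_, ?_⟩
  · have h1 : ContDiff ℝ ∞ fun q : ℝ × ℝ × ℝ => (η q.1 : ℂ) :=
      Complex.ofRealCLM.contDiff.comp (hη.comp contDiff_fst)
    exact Complex.reCLM.contDiff.comp ((h1.mul contDiff_const).mul
      ((contDiff_torusChar p).comp contDiff_snd))
  · obtain ⟨a, b, ha, hab, h⟩ := hsupp
    exact ⟨a, b, ha, hab, fun t ht z => by simp [trigPoly, h t ht]⟩

theorem integral_re_const_mul {F : Torus2 → ℂ} (hF : Integrable F) (c : ℂ) :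
    ∫ z, (c * F z).re = (c * ∫ z, F z).re := by
  rw [← integral_const_mul]
  exact integral_re (hF.const_mul c)

theorem integral_mul_trigPoly (f : L2Torus) (c : ℂ) (p : ℤ × ℤ) :
    ∫ z, f z * trigPoly c p z = (c * (2 * π * torusCoeff f (-p))).re := by
  have hpi : (2 * π : ℂ) ≠ 0 := by exact_mod_cast Real.two_pi_pos.ne'
  rw [torusCoeff_eq_integral, neg_neg, mul_inv_cancel_left₀ hpi,
    ← integral_re_const_mul (integrable_mul_torusChar f p)]
  refine integral_congr_ae (ae_of_all _ fun z => ?_)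
  simp only [trigPoly]
  rw [mul_left_comm, Complex.re_ofReal_mul]

/-! ### Fourier coefficients of weak derivatives -/

theorem eq_zero_of_forall_re_mul {w : ℂ} (h : ∀ c : ℂ, (c * w).re = 0) : w = 0 := by
  have h1 := h (conj w)
  rw [← Complex.normSq_eq_conj_mul_self, Complex.ofReal_re] at h1
  exact Complex.normSq_eq_zero.1 h1

theorem HasWeakPartialX.torusCoeff {f g : L2Torus} (h : HasWeakPartialX f g) (p : ℤ × ℤ) :
    torusCoeff g p = Complex.I * p.1 * torusCoeff f p := by
  have hpi : (2 * π : ℂ) ≠ 0 := by exact_mod_cast Real.two_pi_pos.ne'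
  have key : 2 * π * (_root_.torusCoeff g p - Complex.I * p.1 * _root_.torusCoeff f p) = 0 := by
    refine eq_zero_of_forall_re_mul fun c => ?_
    have h1 := h (trigPoly c (-p)) (smoothOnTorus_trigPoly _ _)
    rw [partialX_trigPoly, integral_mul_trigPoly, integral_mul_trigPoly, neg_neg,
      ← add_eq_zero_iff_eq_neg, ← Complex.add_re] at h1
    rw [← h1]
    congr 1
    push_cast [Prod.fst_neg]
    ring
  exact sub_eq_zero.1 ((mul_eq_zero.1 key).resolve_left hpi)

theorem HasWeakPartialY.torusCoeff {f g : L2Torus} (h : HasWeakPartialY f g) (p : ℤ × ℤ) :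
    torusCoeff g p = Complex.I * p.2 * torusCoeff f p := by
  have hpi : (2 * π : ℂ) ≠ 0 := by exact_mod_cast Real.two_pi_pos.ne'
  have key : 2 * π * (_root_.torusCoeff g p - Complex.I * p.2 * _root_.torusCoeff f p) = 0 := by
    refine eq_zero_of_forall_re_mul fun c => ?_
    have h1 := h (trigPoly c (-p)) (smoothOnTorus_trigPoly _ _)
    rw [partialY_trigPoly, integral_mul_trigPoly, integral_mul_trigPoly, neg_neg,
      ← add_eq_zero_iff_eq_neg, ← Complex.add_re] at h1
    rw [← h1]
    congr 1
    push_cast [Prod.snd_neg]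
    ring
  exact sub_eq_zero.1 ((mul_eq_zero.1 key).resolve_left hpi)

/-- Parseval's identity for the `H¹` norm. -/
theorem hasSum_sobolev {f g₁ g₂ : L2Torus} (h₁ : HasWeakPartialX f g₁)
    (h₂ : HasWeakPartialY f g₂) :
    HasSum (fun p : ℤ × ℤ => (1 + (p.1 : ℝ) ^ 2 + (p.2 : ℝ) ^ 2) * ‖torusCoeff f p‖ ^ 2)
      (‖f‖ ^ 2 + ‖g₁‖ ^ 2 + ‖g₂‖ ^ 2) := by
  refine (((hasSum_sq_torusCoeff f).add (hasSum_sq_torusCoeff g₁)).add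
    (hasSum_sq_torusCoeff g₂)).congr_fun fun p => ?_
  rw [h₁.torusCoeff, h₂.torusCoeff]
  simp only [norm_mul, Complex.norm_I, one_mul, Complex.norm_intCast, mul_pow, sq_abs]
  ring

theorem injective_prodMk (k : ℤ) : Function.Injective fun n : ℤ => (k, n) :=
  fun _ _ h => (Prod.ext_iff.1 h).2

theorem hasSum_fiber_le {F : ℤ × ℤ → ℝ} (hF0 : ∀ p, 0 ≤ F p) {s : ℝ} (hF : HasSum F s) (k : ℤ) :
    (Summable fun n => F (k, n)) ∧ ∑' n, F (k, n) ≤ s := by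
  have h1 : Summable fun n => F (k, n) := hF.summable.comp_injective (injective_prodMk k)
  refine ⟨h1, ?_⟩
  rw [← hF.tsum_eq]
  exact h1.tsum_le_tsum_of_inj _ (injective_prodMk k) (fun p _ => hF0 p) (fun _ => le_rfl)
    hF.summable

/-! ### The Fourier coefficients of a solution -/

theorem IsPrimitive.of_re_im {f f' : ℝ → ℂ} (hre : IsPrimitive (fun t => (f t).re) fun t => (f' t).re)
    (him : IsPrimitive (fun t => (f t).im) fun t => (f' t).im) : IsPrimitive f f' := by
  refine ((hre.clm Complex.ofRealCLM).add (him.clm (Complex.I • Complex.ofRealCLM))).congr_ae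
    (fun t _ => ?_) (ae_of_all _ fun t => ?_)
  · simp [mul_comm Complex.I, Complex.re_add_im]
  · simp [mul_comm Complex.I, Complex.re_add_im]

theorem MemLinftyL2.ae_memLp {U : ℝ → Tor → ℝ} (hU : MemLinftyL2 U) :
    ∀ᵐ t ∂(volume.restrict (Ioi (0 : ℝ))), MemLp (U t) 2 ∧ (eLpNorm (U t) 2 volume).toReal ≤
      (essSup (fun t => eLpNorm (U t) 2 (volume : Measure Tor))
        (volume.restrict (Ioi (0 : ℝ)))).toReal := by
  filter_upwards [hU.1.prodMk_left, ENNReal.ae_le_essSup (μ := volume.restrict (Ioi (0 : ℝ)))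
    (fun t => eLpNorm (U t) 2 (volume : Measure Tor))] with t h1 h2
  exact ⟨⟨h1, h2.trans_lt hU.2⟩, ENNReal.toReal_mono hU.2.ne h2⟩

theorem MemLinftyL2.aestronglyMeasurable_fourierCoeff {U : ℝ → Tor → ℝ} (hU : MemLinftyL2 U)
    (j : ℤ) : AEStronglyMeasurable (fun t => fourierCoeff (fun y => (U t y : ℂ)) j)
      (volume.restrict (Ioi (0 : ℝ))) := by
  have h1 : AEStronglyMeasurable (fun q : ℝ × Tor => (fourier (-j) q.2 : ℂ) • (U q.1 q.2 : ℂ))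
      ((volume.restrict (Ioi (0 : ℝ))).prod (volume : Measure Tor)) := by
    have hU1 := Complex.continuous_ofReal.comp_aestronglyMeasurable hU.1
    have hf : AEStronglyMeasurable (fun q : ℝ × Tor => (fourier (-j) q.2 : ℂ))
        ((volume.restrict (Ioi (0 : ℝ))).prod (volume : Measure Tor)) :=
      ((fourier (-j)).continuous.comp continuous_snd).aestronglyMeasurable
    exact hf.smul hU1
  have h2 := (h1.integral_prod_right').const_smul ((2 * π)⁻¹ : ℝ)
  refine h2.congr (ae_of_all _ fun t => ?_)
  exact (AddCircle.integral_haarAddCircle (T := 2 * π)).symm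

theorem integrable_mul_shear_mul_torusChar (f : L2Torus) {V : Tor → ℝ} (hV : MemLp V 2)
    (p : ℤ × ℤ) : Integrable fun z => (f z : ℂ) * V z.2 * torusChar p z := by
  have hVz : MemLp (fun z : Torus2 => V z.2) 2 volume := hV.comp_snd (volume : Measure Tor)
  have h := ((Lp.memLp f).integrable_mul hVz).ofReal (𝕜 := ℂ)
  refine (h.mul_bdd (c := 1) (torusChar p).continuous.aestronglyMeasurable
    (ae_of_all _ fun z => (norm_torusChar p z).le)).congr (ae_of_all _ fun z => ?_)
  simp

/-- The distributional equation tested against a single Fourier mode. -/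
theorem integral_test_trigPoly (f : L2Torus) {V : Tor → ℝ} (hV : MemLp V 2) (η η' : ℝ) (c : ℂ)
    (k n : ℤ) :
    ∫ z, f z * (trigPoly (η' * c) (-(k, n)) z + V z.2 * partialX (trigPoly (η * c) (-(k, n))) z
        + laplacianT (trigPoly (η * c) (-(k, n))) z)
      = 2 * π * (η' * (c * torusCoeff f (k, n)).re
        + η * (c * (-(((k : ℝ) ^ 2 + (n : ℝ) ^ 2 : ℝ) : ℂ) * torusCoeff f (k, n)
          + -(Complex.I * (k : ℝ)) * ∑' p, fourierCoeff (fun y => (V y : ℂ)) (n - p) *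
            torusCoeff f (k, p))).re) := by
  have hpi : (2 * π : ℂ) ≠ 0 := by exact_mod_cast Real.two_pi_pos.ne'
  rw [(hasSum_convolution hV f k n).tsum_eq, torusCoeff_eq_integral]
  have h1 := integrable_mul_torusChar f (-(k, n))
  have h2 := integrable_mul_shear_mul_torusChar f hV (-(k, n))
  have e : ∀ z, f z * (trigPoly (η' * c) (-(k, n)) z
      + V z.2 * partialX (trigPoly (η * c) (-(k, n))) z
        + laplacianT (trigPoly (η * c) (-(k, n))) z)
      = ((η' * c - (((k : ℝ) ^ 2 + (n : ℝ) ^ 2 : ℝ) : ℂ) * (η * c)) *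
          ((f z : ℂ) * torusChar (-(k, n)) z)).re
        + (-(Complex.I * (k : ℝ)) * (η * c) * ((f z : ℂ) * V z.2 * torusChar (-(k, n)) z)).re := by
    intro z
    rw [partialX_trigPoly, laplacianT_trigPoly]
    simp only [trigPoly]
    rw [mul_add, mul_add, ← mul_assoc (f z) (V z.2), ← Complex.re_ofReal_mul,
      ← Complex.re_ofReal_mul, ← Complex.re_ofReal_mul, ← Complex.add_re, ← Complex.add_re,
      ← Complex.add_re]
    congr 1
    push_cast [Prod.fst_neg, Prod.snd_neg]
    ring
  simp only [e]
  have i1 : ∀ d : ℂ, Integrable fun z => (d * ((f z : ℂ) * torusChar (-(k, n)) z)).re :=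
    fun d => (h1.const_mul d).re
  have i2 : ∀ d : ℂ, Integrable fun z => (d * ((f z : ℂ) * V z.2 * torusChar (-(k, n)) z)).re :=
    fun d => (h2.const_mul d).re
  rw [integral_add (i1 _) (i2 _), integral_re_const_mul h1,
    integral_re_const_mul h2, ← Complex.re_ofReal_mul, ← Complex.re_ofReal_mul, ← Complex.add_re,
    ← Complex.add_re]
  have h3 : ((2 * π : ℝ) : ℂ) = 2 * π := by push_cast; ring
  rw [← Complex.re_ofReal_mul, h3]
  congr 1
  field_simp
  ring

variable {U : ℝ → Tor → ℝ} {ρ₀ : L2Torus} {ρ : ℝ → L2Torus}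

theorem IsSolution.sobolev_bound (h : IsSolution U ρ₀ ρ) :
    ∃ H : ℝ → ℝ, (∀ T, 0 ≤ T → IntervalIntegrable H volume 0 T) ∧
      ∀ᵐ t ∂(volume.restrict (Ioi (0 : ℝ))), ∃ s, HasSum (fun p : ℤ × ℤ =>
        (1 + (p.1 : ℝ) ^ 2 + (p.2 : ℝ) ^ 2) * ‖torusCoeff (ρ t) p‖ ^ 2) s ∧ s ≤ H t := by
  obtain ⟨g₁, g₂, hg, hLp⟩ := h.memL2H1
  refine ⟨fun t => ‖ρ t‖ ^ 2 + ‖g₁ t‖ ^ 2 + ‖g₂ t‖ ^ 2, fun T hT => ?_, ?_⟩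
  · obtain ⟨h0, h1, h2⟩ := hLp (T + 1) (by linarith)
    rw [intervalIntegrable_iff_integrableOn_Ioc_of_le hT]
    have : IntegrableOn (fun t => ‖ρ t‖ ^ 2 + ‖g₁ t‖ ^ 2 + ‖g₂ t‖ ^ 2) (Ioo 0 (T + 1)) :=
      ((h0.integrable_norm_pow two_ne_zero).add (h1.integrable_norm_pow two_ne_zero)).add
        (h2.integrable_norm_pow two_ne_zero)
    exact this.mono_set fun t ht => ⟨ht.1, by linarith [ht.2]⟩
  · exact hg.mono fun t ht => ⟨_, hasSum_sobolev ht.1 ht.2, le_rfl⟩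

theorem sum_fiber_torusCoeff_le (f : L2Torus) (k : ℤ) :
    (Summable fun n => ‖torusCoeff f (k, n)‖ ^ 2) ∧ ∑' n, ‖torusCoeff f (k, n)‖ ^ 2 ≤ ‖f‖ ^ 2 :=
  hasSum_fiber_le (F := fun p => ‖torusCoeff f p‖ ^ 2) (fun p => by positivity)
    (hasSum_sq_torusCoeff f) k

/-- The norm of the shear profile in `L^∞((0, ∞); L²(𝕋))`. -/
def shearNorm (U : ℝ → Tor → ℝ) : ℝ :=
  (essSup (fun t => eLpNorm (U t) 2 (volume : Measure Tor)) (volume.restrict (Ioi (0 : ℝ)))).toReal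

/-- The shear preserves the frequency in `x`, so that the Fourier coefficients of a solution
decouple into the systems `ModeSystem k`. -/
theorem IsSolution.modeSystem (h : IsSolution U ρ₀ ρ) (hU : MemLinftyL2 U) (k : ℤ) :
    ModeSystem k (shearNorm U) (fun n t => torusCoeff (ρ t) (k, n))
      (fun j t => fourierCoeff (fun y => (U t y : ℂ)) j) := by
  have hM : 0 ≤ shearNorm U := ENNReal.toReal_nonneg
  have hub : ∀ᵐ t ∂(volume.restrict (Ioi (0 : ℝ))),
      (Summable fun j => ‖fourierCoeff (fun y => (U t y : ℂ)) j‖ ^ 2) ∧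
        ∑' j, ‖fourierCoeff (fun y => (U t y : ℂ)) j‖ ^ 2 ≤ shearNorm U ^ 2 := by
    filter_upwards [hU.ae_memLp] with t ht
    obtain ⟨h1, h2⟩ := hasSum_sq_fourierCoeff_ofReal ht.1
    exact ⟨h1, h2.trans (pow_le_pow_left₀ ENNReal.toReal_nonneg ht.2 2)⟩
  have hac : ∀ n, ContinuousOn (fun t => torusCoeff (ρ t) (k, n)) (Ici 0) := fun n =>
    (continuous_torusCoeff (k, n)).comp_continuousOn h.continuousOn
  refine ⟨hM, fun t _ => (sum_fiber_torusCoeff_le (ρ t) k).1, ?_, hub,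
    ae_of_all _ fun t j => fourierCoeff_ofReal_neg (U t) j, fun n => ?_⟩
  · obtain ⟨H, hH, hHb⟩ := h.sobolev_bound
    refine ⟨H, hH, hHb.mono fun t ht => ?_⟩
    obtain ⟨s, hs, hsH⟩ := ht
    obtain ⟨h1, h2⟩ := hasSum_fiber_le (fun p => by positivity) hs k
    exact ⟨h1, h2.trans hsH⟩
  · set b : ℝ → ℂ := fun t => -((((k : ℝ) ^ 2 + (n : ℝ) ^ 2 : ℝ)) : ℂ) * torusCoeff (ρ t) (k, n)
      + -(Complex.I * (k : ℝ)) * ∑' p, fourierCoeff (fun y => (U t y : ℂ)) (n - p) *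
        torusCoeff (ρ t) (k, p) with hb
    have hconv : AEStronglyMeasurable (fun t => ∑' p, fourierCoeff (fun y => (U t y : ℂ)) (n - p) *
        torusCoeff (ρ t) (k, p)) (volume.restrict (Ioi (0 : ℝ))) := by
      refine aestronglyMeasurable_of_tendsto_ae atTop (f := fun (N : ℕ) t =>
        ∑ p ∈ Finset.Icc (-(N : ℤ)) N, fourierCoeff (fun y => (U t y : ℂ)) (n - p) *
          torusCoeff (ρ t) (k, p)) (fun N => ?_) ?_
      · refine Finset.aestronglyMeasurable_fun_sum _ fun p _ => ?_
        exact (hU.aestronglyMeasurable_fourierCoeff _).mul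
          (((hac p).mono Ioi_subset_Ici_self).aestronglyMeasurable measurableSet_Ioi)
      · filter_upwards [hub] with t ht
        exact (convolution_bound hM ht.1 ht.2 (sum_fiber_torusCoeff_le (ρ t) k).1
          n).1.hasSum.comp Finset.tendsto_Icc_neg
    have hbint : ∀ T, 0 ≤ T → IntervalIntegrable b volume 0 T := by
      intro T hT
      have hsub : uIcc 0 T ⊆ Ici 0 := by rw [uIcc_of_le hT]; exact Icc_subset_Ici_self
      refine (((hac n).mono hsub).intervalIntegrable.const_mul _).add
        (IntervalIntegrable.const_mul ?_ _)
      have hρ : IntervalIntegrable (fun t => shearNorm U * ‖ρ t‖) volume 0 T :=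
        ((h.continuousOn.mono hsub).norm.intervalIntegrable).const_mul _
      rw [intervalIntegrable_iff_integrableOn_Ioc_of_le hT] at hρ ⊢
      refine Integrable.mono' hρ (hconv.mono_set Ioc_subset_Ioi_self) ?_
      filter_upwards [ae_restrict_of_ae_restrict_of_subset Ioc_subset_Ioi_self hub] with t ht
      obtain ⟨h1, h2⟩ := sum_fiber_torusCoeff_le (ρ t) k
      refine (convolution_bound hM ht.1 ht.2 h1 n).2.trans ?_
      gcongr
      exact (Real.sqrt_le_sqrt h2).trans_eq (Real.sqrt_sq (norm_nonneg _))
    have hre : ∀ c : ℂ, IsPrimitive (fun t => (c * torusCoeff (ρ t) (k, n)).re)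
        (fun t => (c * b t).re) := by
      intro c
      refine isPrimitive_of_weak_deriv
        (Complex.continuous_re.comp_continuousOn (continuousOn_const.mul (hac n)))
        (fun T hT => ?_) fun η hη hsupp => ?_
      · have hi : IntervalIntegrable (fun t => c * b t) volume 0 T := (hbint T hT).const_mul c
        exact ⟨hi.1.re, hi.2.re⟩
      · have heq := h.equation _ (isTestFunction_trigPoly hη hsupp c (-(k, n)))
        have hpi : (2 * π : ℝ) ≠ 0 := Real.two_pi_pos.ne'
        rw [← mul_right_inj' hpi, mul_zero, ← integral_const_mul]
        refine Eq.trans (integral_congr_ae ?_) heq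
        filter_upwards [hU.ae_memLp] with t ht
        rw [hb, ← integral_test_trigPoly (ρ t) ht.1]
        refine integral_congr_ae (ae_of_all _ fun z => ?_)
        have hd : deriv (fun s => trigPoly (η s * c) (-(k, n)) z) t
            = trigPoly (deriv η t * c) (-(k, n)) z := by
          have e : ∀ r : ℝ, trigPoly (r * c) (-(k, n)) z = r * trigPoly c (-(k, n)) z := by
            intro r
            rw [trigPoly, trigPoly, mul_assoc, Complex.re_ofReal_mul]
          simp only [e]
          exact deriv_mul_const_field _
        simp only [hd]
    have h1 := hre 1
    have h2 := hre (-Complex.I)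
    simp only [one_mul] at h1
    refine IsPrimitive.of_re_im h1 (h2.congr_ae (fun t _ => ?_) (ae_of_all _ fun t => ?_)) <;> simp

/-! ### Summation over the streamwise frequencies -/

theorem hasSum_sum_sq_torusCoeff (f : L2Torus) :
    HasSum (fun k : ℤ => ∑' n : ℤ, ‖torusCoeff f (k, n)‖ ^ 2) (‖f‖ ^ 2) :=
  (hasSum_sq_torusCoeff f).prod_fiberwise fun k => (sum_fiber_torusCoeff_le f k).1.hasSum

theorem le_of_sq_le_mul_exp {x y c t : ℝ} (hy : 0 ≤ y)
    (h : x ^ 2 ≤ y ^ 2 * Real.exp (2 * (c * t))) : x ≤ y * Real.exp (c * t) := by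
  refine le_of_pow_le_pow_left₀ two_ne_zero (by positivity) ?_
  rw [mul_pow, ← Real.exp_nat_mul]
  exact_mod_cast h

theorem one_le_intCast_sq {n : ℤ} (hn : n ≠ 0) : (1 : ℝ) ≤ (n : ℝ) ^ 2 := by
  have h : (1 : ℤ) ≤ n ^ 2 := by
    have := Int.one_le_abs hn
    rw [← sq_abs]
    nlinarith
  exact_mod_cast h

/-- Since the mean vanishes, the Poincaré inequality on the torus gives decay with rate `1`. -/
theorem IsSolution.norm_le (hU : MemLinftyL2 U) (hmean : ∫ z, ρ₀ z = 0) {ρ : ℝ → L2Torus}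
    (h : IsSolution U ρ₀ ρ) {t : ℝ} (ht : 0 ≤ t) : ‖ρ t‖ ≤ ‖ρ₀‖ * Real.exp (-1 * t) := by
  -- the mode `(0, 0)` is conserved
  have h00 : ∀ s, 0 ≤ s → torusCoeff (ρ s) (0, 0) = 0 := by
    intro s hs
    have := ((h.modeSystem hU 0).evolution 0).2 s hs
    simp only [Int.cast_zero, ne_eq, OfNat.ofNat_ne_zero, not_false_eq_true, zero_pow, add_zero,
      Complex.ofReal_zero, neg_zero, zero_mul, mul_zero, intervalIntegral.integral_zero] at this
    rw [this, h.initial, torusCoeff_eq_integral]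
    have h1 : ∀ z, (ρ₀ z : ℂ) * torusChar (-(0, 0)) z = ((ρ₀ z : ℝ) : ℂ) := fun z => by
      simp [torusChar_apply]
    simp only [h1]
    rw [integral_complex_ofReal, hmean]
    simp
  refine le_of_sq_le_mul_exp (norm_nonneg _) ?_
  have hsum0 := (hasSum_sum_sq_torusCoeff ρ₀).mul_right (Real.exp (-2 * t))
  have e : 2 * (-1 * t) = -2 * t := by ring
  rw [e]
  refine hasSum_le (fun k => ?_) (hasSum_sum_sq_torusCoeff (ρ t)) hsum0
  have := (h.modeSystem hU k).decay (fun n s hs => ?_) ht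
  · simpa only [h.initial] using this
  · by_cases hk : k = 0
    · subst hk
      by_cases hn : n = 0
      · subst hn
        exact Or.inr (h00 s hs)
      · exact Or.inl (by linarith [one_le_intCast_sq hn, sq_nonneg (((0 : ℤ) : ℝ))])
    · exact Or.inl (by linarith [one_le_intCast_sq hk, sq_nonneg (n : ℝ)])

/-- The lower bound for initial data in `L²`: all but a small fraction of the initial energy is
carried by finitely many Fourier modes. -/
theorem exists_lower_bound (hU : MemLinftyL2 U) (ρ₀ : L2Torus) {θ : ℝ} (hθ0 : 0 < θ)
    (hθ1 : θ < 1) :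
    ∃ c₂ : ℝ, 1 < c₂ ∧ ∀ ρ : ℝ → L2Torus, IsSolution U ρ₀ ρ → ∀ t : ℝ, 0 ≤ t →
      θ * ‖ρ₀‖ * Real.exp (-c₂ * t) ≤ ‖ρ t‖ := by
  obtain ⟨S, hS⟩ : ∃ S : Finset (ℤ × ℤ), (θ * ‖ρ₀‖) ^ 2 ≤ ∑ p ∈ S, ‖torusCoeff ρ₀ p‖ ^ 2 := by
    rcases (norm_nonneg ρ₀).eq_or_lt with h | h
    · exact ⟨∅, by simp [← h]⟩
    · have hlt : (θ * ‖ρ₀‖) ^ 2 < ‖ρ₀‖ ^ 2 := by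
        rw [mul_pow]
        have : θ ^ 2 < 1 := by nlinarith
        nlinarith [pow_pos h 2]
      obtain ⟨S, hS⟩ := ((hasSum_sq_torusCoeff ρ₀).eventually (lt_mem_nhds hlt)).exists
      exact ⟨S, hS.le⟩
  set K := S.image Prod.fst
  set T := S.image Prod.snd
  choose β hβ using fun k : ℤ => ModeSystem.exists_exp_lower_bound k (shearNorm U)
    (sum_fiber_torusCoeff_le ρ₀ k).1 T
  refine ⟨2 + ∑ k ∈ K, |β k|, ?_, fun ρ h t ht => ?_⟩
  · have : 0 ≤ ∑ k ∈ K, |β k| := Finset.sum_nonneg fun k _ => abs_nonneg _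
    linarith
  set c := 2 + ∑ k ∈ K, |β k| with hc
  refine le_of_pow_le_pow_left₀ two_ne_zero (norm_nonneg _) ?_
  have hsub : S ⊆ K ×ˢ T := Finset.subset_product
  calc (θ * ‖ρ₀‖ * Real.exp (-c * t)) ^ 2
      = (θ * ‖ρ₀‖) ^ 2 * Real.exp (-(2 * c) * t) := by
        rw [mul_pow _ (Real.exp _), ← Real.exp_nat_mul]; congr 2; push_cast; ring
    _ ≤ (∑ p ∈ K ×ˢ T, ‖torusCoeff ρ₀ p‖ ^ 2) * Real.exp (-(2 * c) * t) := by
        gcongr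
        exact hS.trans (Finset.sum_le_sum_of_subset_of_nonneg hsub fun _ _ _ => by positivity)
    _ = ∑ k ∈ K, (∑ n ∈ T, ‖torusCoeff ρ₀ (k, n)‖ ^ 2) * Real.exp (-(2 * c) * t) := by
        rw [Finset.sum_product, Finset.sum_mul]
    _ ≤ ∑ k ∈ K, ∑' n, ‖torusCoeff (ρ t) (k, n)‖ ^ 2 := by
        refine Finset.sum_le_sum fun k hk => ?_
        refine le_trans ?_ (hβ k _ _ (h.modeSystem hU k) (fun n => by rw [h.initial]) t ht)
        have h1 : |β k| ≤ ∑ k ∈ K, |β k| :=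
          Finset.single_le_sum (f := fun k => |β k|) (fun _ _ => abs_nonneg _) hk
        have h2 := le_abs_self (β k)
        have h3 := abs_nonneg (β k)
        gcongr
        linarith
    _ ≤ ‖ρ t‖ ^ 2 := sum_le_hasSum K (fun k _ => tsum_nonneg fun n => by positivity)
        (hasSum_sum_sq_torusCoeff (ρ t))

/-- For initial data in `H¹` the squared norm decreases at most linearly in time. -/
theorem exists_linear_bound (hU : MemLinftyL2 U) (h₁ : MemH1 ρ₀) :
    ∃ γ : ℝ, 0 < γ ∧ ∀ ρ : ℝ → L2Torus, IsSolution U ρ₀ ρ → ∀ t : ℝ, 0 ≤ t →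
      ‖ρ₀‖ ^ 2 - γ * t ≤ ‖ρ t‖ ^ 2 := by
  obtain ⟨g₁, g₂, hg₁, hg₂⟩ := h₁
  have hG := hasSum_sobolev hg₁ hg₂
  have hfib := hG.prod_fiberwise fun k => (hasSum_fiber_le (fun p => by positivity) hG k).1.hasSum
  set C := 1 + shearNorm U * wienerConst
  refine ⟨2 * C ^ 2 * (‖ρ₀‖ ^ 2 + ‖g₁‖ ^ 2 + ‖g₂‖ ^ 2) + 1, by positivity, fun ρ h t ht => ?_⟩
  have hle := hasSum_le (fun k => ?_)
    ((hasSum_sum_sq_torusCoeff ρ₀).sub (hasSum_sum_sq_torusCoeff (ρ t)))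
    (hfib.mul_left (2 * t * C ^ 2))
  · linarith
  · have := (h.modeSystem hU k).energy_loss_le ?_ ht
    · simp only [h.initial] at this
      refine this.trans_eq ?_
      ring
    · simp only [h.initial]
      exact (hasSum_fiber_le (fun p => by positivity) hG k).1

/-- The lower bound without loss of a constant, for initial data in `H¹`: linear decrease of the
squared norm for small times, and the lower bound with `θ = 1 / 2` afterwards. -/
theorem exists_sharp_lower_bound (hU : MemLinftyL2 U) (h₁ : MemH1 ρ₀) :
    ∃ c₂ : ℝ, 1 < c₂ ∧ ∀ ρ : ℝ → L2Torus, IsSolution U ρ₀ ρ → ∀ t : ℝ, 0 ≤ t →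
      ‖ρ₀‖ * Real.exp (-c₂ * t) ≤ ‖ρ t‖ := by
  rcases (norm_nonneg ρ₀).eq_or_lt with h0 | h0
  · exact ⟨2, one_lt_two, fun ρ _ t _ => by simp [← h0]⟩
  obtain ⟨γ, hγ, hlin⟩ := exists_linear_bound hU h₁
  obtain ⟨c, hc, hlow⟩ := exists_lower_bound hU ρ₀ (θ := 1 / 2) (by norm_num) (by norm_num)
  set r := γ / ‖ρ₀‖ ^ 2 with hr
  have hr0 : 0 < r := by positivity
  have hγr : γ = r * ‖ρ₀‖ ^ 2 := by rw [hr]; field_simp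
  refine ⟨c + 2 * r, by linarith, fun ρ h t ht => ?_⟩
  rcases le_total (r * t) (1 / 2) with hrt | hrt
  · -- `1 - x ≥ exp (-2 x)` for `0 ≤ x ≤ 1 / 2`, with `x = r t`
    have hrt0 : 0 ≤ r * t := by positivity
    have hexp : Real.exp (-(2 * (r * t))) ≤ 1 - r * t := by
      rw [Real.exp_neg, inv_le_comm₀ (Real.exp_pos _) (by linarith)]
      refine le_trans ?_ (Real.add_one_le_exp _)
      rw [inv_le_iff_one_le_mul₀ (by linarith)]
      nlinarith
    refine le_of_pow_le_pow_left₀ two_ne_zero (norm_nonneg _) ?_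
    calc (‖ρ₀‖ * Real.exp (-(c + 2 * r) * t)) ^ 2
        = ‖ρ₀‖ ^ 2 * Real.exp (2 * (-(c + 2 * r) * t)) := by
          rw [mul_pow, ← Real.exp_nat_mul]; norm_cast
      _ ≤ ‖ρ₀‖ ^ 2 * Real.exp (-(2 * (r * t))) := by
          gcongr
          nlinarith [mul_nonneg (zero_le_one.trans hc.le) ht]
      _ ≤ ‖ρ₀‖ ^ 2 * (1 - r * t) := by gcongr
      _ = ‖ρ₀‖ ^ 2 - γ * t := by rw [hγr]; ring
      _ ≤ ‖ρ t‖ ^ 2 := hlin ρ h t ht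
  · have hexp : Real.exp (-(2 * (r * t))) ≤ 1 / 2 := by
      rw [Real.exp_neg, one_div]
      refine inv_anti₀ two_pos (le_trans ?_ (Real.add_one_le_exp _))
      linarith
    calc ‖ρ₀‖ * Real.exp (-(c + 2 * r) * t)
        = Real.exp (-(2 * (r * t))) * ‖ρ₀‖ * Real.exp (-c * t) := by
          rw [mul_comm (Real.exp _) ‖ρ₀‖, mul_assoc, ← Real.exp_add]
          congr 2
          ring
      _ ≤ 1 / 2 * ‖ρ₀‖ * Real.exp (-c * t) := by gcongr
      _ ≤ ‖ρ t‖ := hlow ρ h t ht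

end

theorem theorem2 (U : ℝ → Tor → ℝ) (hU : MemLinftyL2 U)
    (ρ₀ : L2Torus) (hmean : ∫ z, ρ₀ z = 0) :
    ∃ c₁ : ℝ, 0 < c₁ ∧
      (∀ θ : ℝ, 0 < θ → θ < 1 → ∃ c₂ : ℝ, c₁ < c₂ ∧
        ∀ ρ : ℝ → L2Torus, IsSolution U ρ₀ ρ → ∀ t : ℝ, 0 ≤ t →
          θ * ‖ρ₀‖ * Real.exp (-c₂ * t) ≤ ‖ρ t‖ ∧ ‖ρ t‖ ≤ ‖ρ₀‖ * Real.exp (-c₁ * t)) ∧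
      (MemH1 ρ₀ → ∃ c₂ : ℝ, c₁ < c₂ ∧
        ∀ ρ : ℝ → L2Torus, IsSolution U ρ₀ ρ → ∀ t : ℝ, 0 ≤ t →
          ‖ρ₀‖ * Real.exp (-c₂ * t) ≤ ‖ρ t‖ ∧ ‖ρ t‖ ≤ ‖ρ₀‖ * Real.exp (-c₁ * t)) := by
  refine ⟨1, one_pos, fun θ hθ0 hθ1 => ?_, fun h₁ => ?_⟩
  · obtain ⟨c₂, hc, h⟩ := exists_lower_bound hU ρ₀ hθ0 hθ1
    exact ⟨c₂, hc, fun ρ hρ t ht => ⟨h ρ hρ t ht, hρ.norm_le hU hmean ht⟩⟩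
  · obtain ⟨c₂, hc, h⟩ := exists_sharp_lower_bound hU h₁
    exact ⟨c₂, hc, fun ρ hρ t ht => ⟨h ρ hρ t ht, hρ.norm_le hU hmean ht⟩⟩
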